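/- Let $n\in\mathbb N$ and $\mathcal C=[-1,1]^n$. A city $(S,a,b)$ consists of a Borel measurable, countably $1$-rectifiable set $S\subset\mathbb R^n$ (that is, $S=\bigcup_{i} f_i(A_i)$ for countably many bounded $A_i\subset\mathbb R$ and Lipschitz $f_i:A_i\to\mathbb R^n$), a lower semicontinuous function $b:S\to[0,\infty)$, and $a\in[0,\infty]$ with $b\le a$ on $S$. For $\Omega\subset\mathbb R^n$ and $x,y\in\mathbb R^n$ put $$d^{\Omega}_{S,a,b}(x,y)=\inf_\gamma\left(\int_{\gamma([0,1])\cap S}b\,\mathrm d\mathcal H^1+a\,\mathcal H^1(\gamma([0,1])\setminus S)\right),$$ where the infimum (equal to $\infty$ if there is no such path) is taken over Lipschitz paths $\gamma:[0,1]\to\Omega$ with $\gamma(0)=x$, $\gamma(1)=y$, and $\infty\cdot0=0$. The generalized urban metric is $d_{S,a,b}=d_{S,a,b}^{\mathbb R^n}$. For probability measures $\mu_+,\mu_-$ on $\mathbb R^n$ and a cost $d$ let $W_d(\mu_+,\mu_-)=\inf_\pi\int d\,\mathrm d\pi\in[0,\infty]$, the infimum being taken over all probability measures $\pi$ on $\mathbb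 R^n\times\mathbb R^n$ with first marginal $\mu_+$ and second marginal $\mu_-$. Let $C^1(\mathcal C)$ be the set of continuous $\varphi:\mathcal C\to\mathbb R$ that are continuously differentiable on $(-1,1)^n$ and whose gradient extends continuously to $\mathcal C$ (the extension is again denoted $\nabla\varphi$). **Theorem.** Let $(S,a,b)$ be a city such that $b$ is bounded away from $0$ on $S$ and the function on $\mathbb R^n$ that equals $b$ on $S$ and $a$ off $S$ is lower semicontinuous. Let $\mu_+,\mu_-$ be probability measures on $\mathbb R^n$ concentrated on $\mathcal C$. If $S\subset\mathcal C$, then, as an equality in $[0,\infty]$, $$W_{d_{S,a,b}}(\mu_+,\mu_-)=\sup_\varphi\int_{\mathcal C}\varphi\,\mathrm d(\mu_+-\mu_-),$$ where the supremum is taken over all $\varphi\in C^1(\mathcal C)$ with $|\nabla\varphi|\le b$ on $S\cap\mathcal C$ and $|\nabla\varphi|\le a$ on $\mathcal C\setminus S$. Without the assumption $S\subset\mathcal C$, the same formula holds with $d^{\mathcal C}_{S,a,b}$ (only paths inside $\mathcal C$) in place of $d_{S,a,b}$. -/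

import Mathlib

open MeasureTheory Set
open scoped ENNReal NNReal

/-- A subset of `ℝⁿ` is countably `1`-rectifiable if it is a countable union of Lipschitz images
of bounded subsets of the line. -/
def IsCountablyOneRectifiable {n : ℕ} (S : Set (EuclideanSpace ℝ (Fin n))) : Prop :=
  ∃ (A : ℕ → Set ℝ) (f : ℕ → ℝ → EuclideanSpace ℝ (Fin n)),
    (∀ i, Bornology.IsBounded (A i) ∧ ∃ K : ℝ≥0, LipschitzOnWith K (f i) (A i)) ∧
      S = ⋃ i, f i '' A i

/-- A city `(S, a, b)` in `ℝⁿ`: a Borel, countably `1`-rectifiable set `S`, a lower semicontinuous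
friction coefficient `b : S → [0, ∞)`, and `a ∈ [0, ∞]` with `b ≤ a` on `S`. -/
structure City (n : ℕ) where
  S : Set (EuclideanSpace ℝ (Fin n))
  a : ℝ≥0∞
  b : S → ℝ≥0
  rectifiable : IsCountablyOneRectifiable S
  measurableSet : MeasurableSet S
  lowerSemicontinuous : LowerSemicontinuous b
  b_le_a : ∀ x : S, (b x : ℝ≥0∞) ≤ a

/-- The cube `[-1, 1]ⁿ`. -/
def cube (n : ℕ) : Set (EuclideanSpace ℝ (Fin n)) :=
  {x | ∀ i, x i ∈ Icc (-1 : ℝ) 1}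

/-- The open cube `(-1, 1)ⁿ`. -/
def openCube (n : ℕ) : Set (EuclideanSpace ℝ (Fin n)) :=
  {x | ∀ i, x i ∈ Ioo (-1 : ℝ) 1}

/-- Lipschitz paths `[0, 1] → Ω` from `x` to `y`. -/
def lipschitzPaths {n : ℕ} (Ω : Set (EuclideanSpace ℝ (Fin n)))
    (x y : EuclideanSpace ℝ (Fin n)) : Set (unitInterval → EuclideanSpace ℝ (Fin n)) :=
  {γ | (∃ K : ℝ≥0, LipschitzWith K γ) ∧ range γ ⊆ Ω ∧ γ 0 = x ∧ γ 1 = y}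

/-- The gradient of `φ`, which exists on `(-1, 1)ⁿ`, extends to the continuous field `g` on
`[-1, 1]ⁿ`, and `φ` is continuous on `[-1, 1]ⁿ`. Thus `φ ∈ C¹([-1, 1]ⁿ)` if and only if some `g`
satisfies this. -/
structure IsC1WithGradient {n : ℕ} (φ : EuclideanSpace ℝ (Fin n) → ℝ)
    (g : EuclideanSpace ℝ (Fin n) → EuclideanSpace ℝ (Fin n)) : Prop where
  continuousOn : ContinuousOn φ (cube n)
  continuousOn_gradient : ContinuousOn g (cube n)
  hasGradientAt : ∀ x ∈ openCube n, HasGradientAt φ (g x) x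

/-- Transport plans between `μ` and `ν`. -/
def transportPlans {n : ℕ} (μ ν : Measure (EuclideanSpace ℝ (Fin n))) :
    Set (Measure (EuclideanSpace ℝ (Fin n) × EuclideanSpace ℝ (Fin n))) :=
  {π | IsProbabilityMeasure π ∧ π.map Prod.fst = μ ∧ π.map Prod.snd = ν}

/-- The Wasserstein distance between `μ` and `ν` with respect to the cost `d`. -/
noncomputable def wasserstein {n : ℕ}
    (d : EuclideanSpace ℝ (Fin n) → EuclideanSpace ℝ (Fin n) → ℝ≥0∞)
    (μ ν : Measure (EuclideanSpace ℝ (Fin n))) : ℝ≥0∞ :=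
  ⨅ π ∈ transportPlans μ ν, ∫⁻ p, d p.1 p.2 ∂π

namespace City

variable {n : ℕ} (X : City n)

open Classical in
/-- The friction function on `ℝⁿ`: `b` on `S` and `a` off `S`. -/
noncomputable def friction (x : EuclideanSpace ℝ (Fin n)) : ℝ≥0∞ :=
  if h : x ∈ X.S then (X.b ⟨x, h⟩ : ℝ≥0∞) else X.a

/-- The urban metric in which only Lipschitz paths inside `Ω` are admitted: the infimum of
`∫_{γ([0,1]) ∩ S} b dℋ¹ + a ℋ¹(γ([0,1]) ∖ S)`. -/
noncomputable def urbanMetricOn (Ω : Set (EuclideanSpace ℝ (Fin n)))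
    (x y : EuclideanSpace ℝ (Fin n)) : ℝ≥0∞ :=
  ⨅ γ ∈ lipschitzPaths Ω x y,
    (∫⁻ z in range γ ∩ X.S, X.friction z ∂(Measure.hausdorffMeasure 1)) +
      X.a * Measure.hausdorffMeasure 1 (range γ \ X.S)

/-- The generalized urban metric `d_{S,a,b}`, with Lipschitz paths in `ℝⁿ`. -/
noncomputable def urbanMetric (x y : EuclideanSpace ℝ (Fin n)) : ℝ≥0∞ :=
  X.urbanMetricOn univ x y

/-- The functions `φ ∈ C¹([-1, 1]ⁿ)` with `|∇φ| ≤ b` on `S ∩ [-1, 1]ⁿ` and `|∇φ| ≤ a` on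
`[-1, 1]ⁿ ∖ S`. -/
def potentials : Set (EuclideanSpace ℝ (Fin n) → ℝ) :=
  {φ | ∃ g, IsC1WithGradient φ g ∧
    (∀ x : X.S, (x : EuclideanSpace ℝ (Fin n)) ∈ cube n → ‖g x‖ ≤ X.b x) ∧
    (∀ x ∈ cube n \ X.S, ‖g x‖ₑ ≤ X.a)}

/-- The supremum of `∫ φ d(μ - ν)` over the cube, for `φ` in `X.potentials`. -/
noncomputable def dualValue (μ ν : Measure (EuclideanSpace ℝ (Fin n))) : EReal :=
  ⨆ φ ∈ X.potentials, (((∫ x in cube n, φ x ∂μ) - ∫ x in cube n, φ x ∂ν : ℝ) : EReal)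

end City

/-! Let F be the friction (b on S, a off S); a path costs the integral of F over its image with
respect to ℋ¹. Weak duality: along a path φ takes every value between its end values, and the
φ-image of the path has length at most ∫ |∇φ| dℋ¹ ≤ ∫ F dℋ¹ (`City.ofReal_sub_le_urbanMetricOn`).
Integrating against a plan gives one inequality.

For the converse, lower semicontinuity gives Lipschitz functions f_k increasing to F. On the compact
cube let d_k be the chain distance with step cost (f_k(x) + (k+1)|x-y|)|x-y|, where the quadratic
term rules out long jumps as k grows. The d_k are continuous and increase with k. Nearly optimal
chains converge to a curve, so the urban metric is at most sup d_k
(`City.urbanMetricOn_le_iSup_cubeDist`); the bound F ≥ c > 0 makes that curve Lipschitz.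

If V bounds the dual problems of all d_k, then M. Riesz extension and the representation theorem
give a single plan π with ∫ d_k dπ ≤ V for every k (`exists_plan_integral_le`), and monotone
convergence bounds the transport cost by V. The dual value is such a V: a dual pair for d_k is
replaced by one function u with u(x) - u(y) at most the step cost, and mollifying and slightly
shrinking u yields an admissible C¹ potential (`City.exists_potential_abs_sub_le`).

When S lies in the cube, the projection onto the cube never raises the cost of a path, so both
metrics agree there. -/

open Filter Topology

/-! ### Chain distances generated by arbitrary step costs. -/

/-- `ChainCost w x y r`: some finite chain of points from `x` to `y` has total step cost `r`. -/
inductive ChainCost {α : Type*} (w : α → α → ℝ) : α → α → ℝ → Prop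
  | nil (x : α) : ChainCost w x x 0
  | cons {x y z : α} {r : ℝ} : ChainCost w y z r → ChainCost w x z (w x y + r)

/-- The infimum of the total step costs of the chains from `x` to `y`. -/
noncomputable def chainDist {α : Type*} (w : α → α → ℝ) (x y : α) : ℝ :=
  sInf {r | ChainCost w x y r}

section Chain

variable {α : Type*} {w w' : α → α → ℝ} {x y z : α} {r s : ℝ}

theorem ChainCost.nonneg (hw : ∀ x y, 0 ≤ w x y) (h : ChainCost w x y r) : 0 ≤ r := by
  induction h with
  | nil => exact le_rfl
  | cons _ ih => exact add_nonneg (hw _ _) ih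

theorem ChainCost.single (w : α → α → ℝ) (x y : α) : ChainCost w x y (w x y) := by
  simpa using (ChainCost.nil y).cons (w := w) (x := x)

theorem ChainCost.trans (h : ChainCost w x y r) (h' : ChainCost w y z s) :
    ChainCost w x z (r + s) := by
  induction h with
  | nil => simpa using h'
  | cons _ ih => rw [add_assoc]; exact (ih h').cons

theorem ChainCost.sub_le {v : α → ℝ} (hv : ∀ x y, v y - v x ≤ w x y) (h : ChainCost w x y r) :
    v y - v x ≤ r := by
  induction h with
  | nil => simp
  | @cons a b c _ _ ih => linarith [hv a b]

theorem bddBelow_chainCost (hw : ∀ x y, 0 ≤ w x y) : BddBelow {r | ChainCost w x y r} :=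
  ⟨0, fun _ h => h.nonneg hw⟩

theorem ChainCost.chainDist_le_cost (hw : ∀ x y, 0 ≤ w x y) (h : ChainCost w x y r) :
    chainDist w x y ≤ r :=
  csInf_le (bddBelow_chainCost hw) h

theorem chainDist_nonneg (hw : ∀ x y, 0 ≤ w x y) : 0 ≤ chainDist w x y :=
  Real.sInf_nonneg fun _ h => h.nonneg hw

theorem chainDist_le (hw : ∀ x y, 0 ≤ w x y) (x y : α) : chainDist w x y ≤ w x y :=
  (ChainCost.single w x y).chainDist_le_cost hw

theorem chainDist_self (hw : ∀ x y, 0 ≤ w x y) (x : α) : chainDist w x x = 0 :=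
  le_antisymm ((ChainCost.nil x).chainDist_le_cost hw) (chainDist_nonneg hw)

theorem le_chainDist (h : ∀ r, ChainCost w x y r → s ≤ r) : s ≤ chainDist w x y :=
  le_csInf ⟨_, ChainCost.single w x y⟩ h

theorem exists_chainCost_lt (h : chainDist w x y < r) : ∃ s < r, ChainCost w x y s := by
  obtain ⟨s, hs, hsr⟩ := exists_lt_of_csInf_lt ⟨_, ChainCost.single w x y⟩ h
  exact ⟨s, hsr, hs⟩

theorem chainDist_triangle (hw : ∀ x y, 0 ≤ w x y) (x y z : α) :
    chainDist w x z ≤ chainDist w x y + chainDist w y z := by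
  refine le_of_forall_pos_lt_add fun ε hε => ?_
  obtain ⟨r, hr, h⟩ := exists_chainCost_lt (lt_add_of_pos_right (chainDist w x y) (half_pos hε))
  obtain ⟨s, hs, h'⟩ := exists_chainCost_lt (lt_add_of_pos_right (chainDist w y z) (half_pos hε))
  linarith [(h.trans h').chainDist_le_cost hw]

/-- Lower bounds for chain distances are obtained below by choosing a test function `v` here. -/
theorem sub_le_chainDist {v : α → ℝ} (hv : ∀ x y, v y - v x ≤ w x y) (x y : α) :
    v y - v x ≤ chainDist w x y :=
  le_chainDist fun _ h => h.sub_le hv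

theorem chainDist_mono (hw : ∀ x y, 0 ≤ w x y) (h : ∀ x y, w x y ≤ w' x y) (x y : α) :
    chainDist w x y ≤ chainDist w' x y := by
  refine le_chainDist fun r hr => ?_
  induction hr with
  | nil x => exact (chainDist_self hw x).le
  | @cons a b c r _ ih =>
    linarith [chainDist_triangle hw a b c, chainDist_le hw a b, h a b]

/-- A chain, run through with its cost as time. -/
theorem ChainCost.exists_curve [PseudoMetricSpace α] (hw : ∀ x y, 0 ≤ w x y) {h : ℝ}
    (hh : 0 ≤ h) (hc : ChainCost w x y r) (hstep : ∀ z z', w z z' ≤ r → dist z z' ≤ h) :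
    ∃ γ : ℝ → α, (∀ t, 0 ≤ t → chainDist w x (γ t) ≤ t) ∧ (∀ t, r ≤ t → γ t = y) ∧
      ∀ s t, 0 ≤ s → s ≤ t → ∃ z, dist (γ s) z ≤ h ∧ chainDist w z (γ t) ≤ t - s := by
  induction hc with
  | nil x =>
    refine ⟨fun _ => x, fun t ht => by rwa [chainDist_self hw], fun _ _ => rfl,
      fun s t _ hst => ⟨x, by simpa using hh, ?_⟩⟩
    rw [chainDist_self hw]
    linarith
  | @cons a b c r hr ih =>
    have hr0 := hr.nonneg hw
    have hab := hw a b
    obtain ⟨γ, h1, h2, h3⟩ := ih fun z z' hz => hstep z z' (by linarith)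
    refine ⟨fun t => if t < w a b then a else γ (t - w a b), fun t ht => ?_, fun t ht => ?_,
      fun s t hs hst => ?_⟩
    · dsimp only
      split_ifs with htw
      · rwa [chainDist_self hw]
      · linarith [h1 (t - w a b) (by linarith), chainDist_triangle hw a b (γ (t - w a b)),
          chainDist_le hw a b]
    · dsimp only
      rw [if_neg (by linarith)]
      exact h2 _ (by linarith)
    · dsimp only
      by_cases hsw : s < w a b
      · rw [if_pos hsw]
        by_cases htw : t < w a b
        · rw [if_pos htw]
          refine ⟨a, by simpa using hh, ?_⟩
          rw [chainDist_self hw]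
          linarith
        · rw [if_neg htw]
          -- The curve waits at `a` until the cost of the first step is paid. If it has left by time
          -- `t`, the intermediate point is the next vertex `b`; the time since the jump is less
          -- than `t - s`.
          exact ⟨b, hstep _ _ (by linarith), by linarith [h1 (t - w a b) (by linarith)]⟩
      · rw [if_neg hsw, if_neg (by linarith)]
        obtain ⟨z, hz, hz'⟩ := h3 (s - w a b) (t - w a b) (by linarith) (by linarith)
        exact ⟨z, hz, by linarith⟩

end Chain

/-! ### Chain distances of friction type and their limit curves. -/

/-- The cost `(f x + M |x - y|) |x - y|` of a step from `x` to `y`. -/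
def stepCost {α : Type*} [PseudoMetricSpace α] (f : α → ℝ) (M : ℝ) (x y : α) : ℝ :=
  (f x + M * dist x y) * dist x y

section StepCost

variable {α : Type*} [MetricSpace α] {f g : α → ℝ} {M N c : ℝ}

theorem stepCost_nonneg (hM : 0 ≤ M) (hf : ∀ x, 0 ≤ f x) (x y : α) : 0 ≤ stepCost f M x y := by
  have := hf x
  unfold stepCost
  positivity

theorem stepCost_mono (hMN : M ≤ N) (hfg : ∀ x, f x ≤ g x) (x y : α) :
    stepCost f M x y ≤ stepCost g N x y := by
  unfold stepCost
  gcongr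
  exact hfg x

theorem mul_dist_le_chainDist (hM : 0 ≤ M) (hf : ∀ x, c ≤ f x) (x y : α) (hc : 0 ≤ c) :
    c * dist x y ≤ chainDist (stepCost f M) x y := by
  have h := sub_le_chainDist (w := stepCost f M) (v := fun z => c * dist x z) (fun z z' => ?_) x y
  · simpa using h
  · have h1 : c * (dist x z' - dist x z) ≤ c * dist z z' := by
      gcongr
      linarith [dist_triangle x z z']
    have h2 : c * dist z z' ≤ stepCost f M z z' := by
      unfold stepCost
      gcongr
      nlinarith [hf z, mul_nonneg hM (dist_nonneg (x := z) (y := z'))]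
    linarith

/-- The test function is `m * dist p z`, truncated at its value at `q`. A step starting within `dist
p q` of `p` has `f z ≥ m` by the Lipschitz bound; a step starting farther away begins at the maximum
and gains nothing. -/
theorem sub_mul_dist_le_chainDist (hM : 0 ≤ M) (hf : ∀ x, 0 ≤ f x)
    (hlip : ∀ x y, f x - f y ≤ M * dist x y) (p q : α) :
    (f p - M * dist p q) * dist p q ≤ chainDist (stepCost f M) p q := by
  set m := f p - M * dist p q with hm
  rcases le_or_gt m 0 with h0 | h0
  · exact (mul_nonpos_of_nonpos_of_nonneg h0 dist_nonneg).trans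
      (chainDist_nonneg (stepCost_nonneg hM hf))
  have h := sub_le_chainDist (w := stepCost f M)
    (v := fun z => min (m * dist p z) (m * dist p q)) (fun z z' => ?_) p q
  · simpa [min_eq_left (mul_nonneg h0.le (dist_nonneg (x := p) (y := q)))] using h
  · have hs := stepCost_nonneg hM hf z z'
    rcases le_total (dist p q) (dist p z) with hz | hz
    · have h1 : min (m * dist p z) (m * dist p q) = m * dist p q :=
        min_eq_right (by gcongr)
      simp only [h1]
      linarith [min_le_right (m * dist p z') (m * dist p q)]
    · have h1 : min (m * dist p z) (m * dist p q) = m * dist p z :=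
        min_eq_left (by gcongr)
      simp only [h1]
      have h2 : m * (dist p z' - dist p z) ≤ m * dist z z' := by
        gcongr
        linarith [dist_triangle p z z']
      have h3 : m * dist z z' ≤ stepCost f M z z' := by
        unfold stepCost
        gcongr
        have : M * dist p z ≤ M * dist p q := by gcongr
        linarith [hlip p z, mul_nonneg hM (dist_nonneg (x := z) (y := z'))]
      linarith [min_le_left (m * dist p z') (m * dist p q)]

theorem stepCost_le (hf : ∀ x, f x ≤ M) (x y : α) :
    stepCost f M x y ≤ M * (1 + dist x y) * dist x y := by
  unfold stepCost
  gcongr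
  linarith [hf x]

theorem continuous_chainDist (hM : 0 ≤ M) (hf : ∀ x, 0 ≤ f x) (hub : ∀ x, f x ≤ M) :
    Continuous fun p : α × α => chainDist (stepCost f M) p.1 p.2 := by
  have hw := stepCost_nonneg hM hf
  rw [continuous_iff_continuousAt]
  rintro ⟨x, y⟩
  have h1 : Tendsto (fun p : α × α => M * (1 + dist p.1 x) * dist p.1 x) (𝓝 (x, y)) (𝓝 0) := by
    refine Continuous.tendsto' (by fun_prop) _ _ (by simp)
  have h2 : Tendsto (fun p : α × α => M * (1 + dist p.2 y) * dist p.2 y) (𝓝 (x, y)) (𝓝 0) := by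
    refine Continuous.tendsto' (by fun_prop) _ _ (by simp)
  rw [ContinuousAt, tendsto_iff_dist_tendsto_zero]
  refine squeeze_zero (fun _ => dist_nonneg) (fun p => ?_) (by simpa using h1.add h2)
  have hle : ∀ a b, chainDist (stepCost f M) a b ≤ M * (1 + dist a b) * dist a b :=
    fun a b => (chainDist_le hw a b).trans (stepCost_le hub a b)
  have a1 := hle p.1 x
  have a2 := hle x p.1
  have a3 := hle p.2 y
  have a4 := hle y p.2
  rw [dist_comm x] at a2
  rw [dist_comm y] at a4
  rw [Real.dist_eq, abs_le]
  constructor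
  · linarith [chainDist_triangle hw x p.1 y, chainDist_triangle hw p.1 p.2 y]
  · linarith [chainDist_triangle hw p.1 x p.2, chainDist_triangle hw x y p.2]

/-- If the chain distances between `x` and `y` stay below `D`, then `x` and `y` are joined by a
curve that is `1`-Lipschitz for all these distances. -/
theorem exists_curve_chainDist_le [CompactSpace α] {f : ℕ → α → ℝ} {c : ℝ} (hc : 0 < c)
    (hf : ∀ k x, c ≤ f k x) (hub : ∀ k x, f k x ≤ k + 1) (hmono : ∀ x, Monotone fun k => f k x)
    {x y : α} {D : ℝ} (hD : ∀ k, chainDist (stepCost (f k) (k + 1)) x y < D) :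
    ∃ γ : ℝ → α, γ 0 = x ∧ γ D = y ∧
      ∀ s t, 0 ≤ s → s ≤ t → ∀ j, chainDist (stepCost (f j) (j + 1)) (γ s) (γ t) ≤ t - s := by
  have hf0 : ∀ k x, 0 ≤ f k x := fun k x => hc.le.trans (hf k x)
  have hw : ∀ (k : ℕ) (x y : α), 0 ≤ stepCost (f k) (k + 1) x y := fun k =>
    stepCost_nonneg (by positivity) (hf0 k)
  have hD0 : 0 ≤ D := (chainDist_nonneg (hw 0)).trans (hD 0).le
  -- A step of cost below `D` satisfies `(k + 1) * dist ^ 2 ≤ D`, which bounds its length by `h k`.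
  set h : ℕ → ℝ := fun k => √(D / (k + 1)) with hh
  have hlim : Tendsto h atTop (𝓝 0) := by
    have h1 : Tendsto (fun k : ℕ => D / ((k : ℝ) + 1)) atTop (𝓝 0) := by
      simpa [div_eq_mul_inv] using (tendsto_one_div_add_atTop_nhds_zero_nat (𝕜 := ℝ)).const_mul D
    simpa [hh, Function.comp_def] using (Real.continuous_sqrt.tendsto 0).comp h1
  have hex : ∀ k : ℕ, ∃ γ : ℝ → α,
      (∀ t, 0 ≤ t → chainDist (stepCost (f k) (k + 1)) x (γ t) ≤ t) ∧ γ D = y ∧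
      ∀ s t, 0 ≤ s → s ≤ t → ∃ z, dist (γ s) z ≤ h k ∧
        chainDist (stepCost (f k) (k + 1)) z (γ t) ≤ t - s := by
    intro k
    obtain ⟨r, hr, hcr⟩ := exists_chainCost_lt (hD k)
    obtain ⟨γ, h1, h2, h3⟩ := hcr.exists_curve (hw k) (Real.sqrt_nonneg (D / (k + 1)))
      fun z z' hz => by
        apply Real.le_sqrt_of_sq_le
        rw [le_div_iff₀ (by positivity)]
        unfold stepCost at hz
        nlinarith [mul_nonneg (hf0 k z) (dist_nonneg (x := z) (y := z'))]
    exact ⟨γ, h1, h2 D hr.le, h3⟩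
  choose γ' h1 h2 h3 using hex
  -- Pointwise limits along one ultrafilter suffice: the estimates on the limit curve come from
  -- continuity of each fixed chain distance.
  have hcpt : ∀ t : ℝ, ∃ p, Tendsto (fun k => γ' k t) (hyperfilter ℕ : Filter ℕ) (𝓝 p) := by
    intro t
    obtain ⟨p, -, hp⟩ := isCompact_univ.ultrafilter_le_nhds
      ((hyperfilter ℕ).map fun k => γ' k t) (by simp)
    exact ⟨p, hp⟩
  choose γ hγ using hcpt
  have hU : (hyperfilter ℕ : Filter ℕ) ≤ atTop := Nat.hyperfilter_le_atTop
  have hdist : ∀ k (a b : α), c * dist a b ≤ chainDist (stepCost (f k) (k + 1)) a b :=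
    fun k a b => mul_dist_le_chainDist (by positivity) (hf k) a b hc.le
  refine ⟨γ, ?_, ?_, fun s t hs hst j => ?_⟩
  · refine tendsto_nhds_unique (hγ 0) (tendsto_const_nhds.congr fun k => ?_)
    have := (hdist k _ _).trans (h1 k 0 le_rfl)
    exact dist_le_zero.1 (by nlinarith [dist_nonneg (x := x) (y := γ' k 0)])
  · exact tendsto_nhds_unique (hγ D) (tendsto_const_nhds.congr fun k => (h2 k).symm)
  · have hcont : Tendsto (fun k => chainDist (stepCost (f j) (j + 1)) (γ' k s) (γ' k t))
        (hyperfilter ℕ : Filter ℕ) (𝓝 (chainDist (stepCost (f j) (j + 1)) (γ s) (γ t))) :=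
      ((continuous_chainDist (by positivity) (hf0 j) (hub j)).tendsto (γ s, γ t)).comp
        ((hγ s).prodMk_nhds (hγ t))
    have hbd : Tendsto (fun k => ((j : ℝ) + 1) * (1 + h k) * h k + (t - s))
        (hyperfilter ℕ : Filter ℕ) (𝓝 (t - s)) := by
      have : Tendsto h (hyperfilter ℕ : Filter ℕ) (𝓝 0) := hlim.mono_left hU
      simpa using ((this.const_add 1).const_mul ((j : ℝ) + 1)).mul this |>.add_const (t - s)
    refine le_of_tendsto_of_tendsto hcont hbd ?_
    filter_upwards [hU (eventually_ge_atTop j)] with k hk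
    obtain ⟨z, hz, hz'⟩ := h3 k s t hs hst
    -- For `k ≥ j` the `k`-th distance dominates the `j`-th, so the `k`-th curve is `1`-Lipschitz
    -- for the `j`-th distance up to one jump of length `h k`.
    have hjk : (j : ℝ) + 1 ≤ k + 1 := by exact_mod_cast Nat.succ_le_succ hk
    have b1 := chainDist_mono (hw j) (stepCost_mono hjk fun x => hmono x hk) z (γ' k t)
    have b2 := chainDist_le (hw j) (γ' k s) z
    have b3 := stepCost_le (hub j) (γ' k s) z
    have b4 : ((j : ℝ) + 1) * (1 + dist (γ' k s) z) * dist (γ' k s) z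
        ≤ ((j : ℝ) + 1) * (1 + h k) * h k := by gcongr
    linarith [chainDist_triangle (hw j) (γ' k s) z (γ' k t)]

end StepCost

/-! ### Comparing Lebesgue measure with weighted ℋ¹-integrals on small pieces. -/

theorem ENNReal.le_of_forall_le_add_ofReal_mul {a b M : ℝ≥0∞} (hM : M ≠ ⊤) {ε₀ : ℝ} (h₀ : 0 < ε₀)
    (h : ∀ ε : ℝ, 0 < ε → ε < ε₀ → a ≤ b + ENNReal.ofReal ε * M) : a ≤ b := by
  have hlim : Tendsto (fun ε : ℝ => b + ENNReal.ofReal ε * M) (𝓝[>] 0) (𝓝 b) := by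
    have h1 : Tendsto (fun ε : ℝ => ENNReal.ofReal ε) (𝓝[>] 0) (𝓝 0) := by
      simpa using (ENNReal.continuous_ofReal.tendsto 0).mono_left nhdsWithin_le_nhds
    simpa using (ENNReal.Tendsto.mul_const h1 (Or.inr hM)).const_add b
  refine ge_of_tendsto hlim ?_
  filter_upwards [Ioo_mem_nhdsGT h₀] with ε hε using h ε hε.1 hε.2

/-- Passes from a bound valid for every sample point of a piece to an integral bound, by comparing
`w` with the constant `B / μ A`. -/
theorem mul_le_setLIntegral_of_forall_mul_le {α : Type*} [MeasurableSpace α] {μ : Measure α} {A : Set α} {B : ℝ≥0∞}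
    {w : α → ℝ≥0∞} (hfin : μ A ≠ ⊤) (hA : MeasurableSet A) (h0 : μ A = 0 → B = 0)
    (h : ∀ z ∈ A, B ≤ w z * μ A) : B ≤ ∫⁻ z in A, w z ∂μ := by
  rcases eq_or_ne (μ A) 0 with h' | h'
  · simp [h0 h']
  · calc B = B / μ A * μ A := (ENNReal.div_mul_cancel h' hfin).symm
      _ = ∫⁻ _ in A, B / μ A ∂μ := by simp
      _ ≤ _ := setLIntegral_mono' hA fun z hz => ENNReal.div_le_of_le_mul (h z hz)

theorem setLIntegral_le_mul_of_forall_mul_le {α : Type*} [MeasurableSpace α] {μ : Measure α} {A : Set α} {B : ℝ≥0∞}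
    {w : α → ℝ≥0∞} (hfin : μ A ≠ ⊤) (hA : MeasurableSet A)
    (h : ∀ z ∈ A, w z * μ A ≤ B) : ∫⁻ z in A, w z ∂μ ≤ B := by
  rcases eq_or_ne (μ A) 0 with h' | h'
  · simp [Measure.restrict_eq_zero.2 h']
  · calc ∫⁻ z in A, w z ∂μ ≤ ∫⁻ _ in A, B / μ A ∂μ :=
        setLIntegral_mono' hA fun z hz =>
          (ENNReal.le_div_iff_mul_le (Or.inl h') (Or.inl hfin)).2 (h z hz)
      _ = B / μ A * μ A := by simp
      _ = B := ENNReal.div_mul_cancel h' hfin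

section Pieces

variable {α : Type*} [MetricSpace α] [SecondCountableTopology α] [Nonempty α]
  [MeasurableSpace α] [BorelSpace α]

theorem exists_measurable_partition_dist_lt {δ : ℝ} (hδ : 0 < δ) :
    ∃ A : ℕ → Set α, (∀ i, MeasurableSet (A i)) ∧ Pairwise (Function.onFun Disjoint A) ∧ (⋃ i, A i) = univ ∧
      ∀ i, ∀ x ∈ A i, ∀ y ∈ A i, dist x y < δ := by
  refine ⟨disjointed fun i => Metric.ball (TopologicalSpace.denseSeq α i) (δ / 2),
    MeasurableSet.disjointed fun i => measurableSet_ball, disjoint_disjointed _, ?_,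
    fun i x hx y hy => ?_⟩
  · rw [iUnion_disjointed]
    refine eq_univ_of_forall fun x => ?_
    obtain ⟨i, hi⟩ := (TopologicalSpace.denseRange_denseSeq α).exists_dist_lt x (half_pos hδ)
    exact mem_iUnion.2 ⟨i, hi⟩
  · have hx' := disjointed_subset _ i hx
    have hy' := disjointed_subset _ i hy
    rw [Metric.mem_ball] at hx' hy'
    linarith [dist_triangle_right x y (TopologicalSpace.denseSeq α i)]

/-- On a piece of diameter below `δ`, `φ` is Lipschitz with constant `G z + ε` for each `z` in the
piece. The resulting bounds on the image, one for each `z`, combine into an integral; summing over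
pieces replaces an area formula. -/
theorem volume_image_le_setLIntegral {R : Set α} (hR : MeasurableSet R)
    (hfin : Measure.hausdorffMeasure 1 R ≠ ⊤) {φ G : α → ℝ} (hG : ∀ x, 0 ≤ G x)
    (h : ∀ ε : ℝ, 0 < ε → ∃ δ > 0, ∀ z ∈ R, ∀ x ∈ R, ∀ y ∈ R, dist x z < δ → dist y z < δ →
      |φ x - φ y| ≤ (G z + ε) * dist x y) :
    volume (φ '' R) ≤ ∫⁻ x in R, ENNReal.ofReal (G x) ∂(Measure.hausdorffMeasure 1) := by
  refine ENNReal.le_of_forall_le_add_ofReal_mul hfin one_pos fun ε hε _ => ?_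
  obtain ⟨δ, hδ, hφ⟩ := h ε hε
  obtain ⟨A, hAm, hAd, hAu, hA⟩ := exists_measurable_partition_dist_lt (α := α) hδ
  have key : ∀ i, ∀ z ∈ R ∩ A i, volume (φ '' (R ∩ A i)) ≤
      ENNReal.ofReal (G z + ε) * Measure.hausdorffMeasure 1 (R ∩ A i) := by
    intro i z hz
    have hL : LipschitzOnWith (Real.toNNReal (G z + ε)) φ (R ∩ A i) := by
      refine LipschitzOnWith.of_dist_le_mul fun x hx y hy => ?_
      rw [Real.dist_eq, Real.coe_toNNReal _ (by linarith [hG z])]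
      exact hφ z hz.1 x hx.1 y hy.1 (hA i x hx.2 z hz.2) (hA i y hy.2 z hz.2)
    have := hL.hausdorffMeasure_image_le (d := 1) zero_le_one
    rw [hausdorffMeasure_real] at this
    simpa [ENNReal.ofReal] using this
  have hfin' : ∀ i, Measure.hausdorffMeasure 1 (R ∩ A i) ≠ ⊤ := fun i =>
    ne_top_of_le_ne_top hfin (measure_mono inter_subset_left)
  have hRA : R = ⋃ i, R ∩ A i := by rw [← inter_iUnion, hAu, inter_univ]
  calc volume (φ '' R) = volume (⋃ i, φ '' (R ∩ A i)) := by rw [← image_iUnion, ← hRA]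
    _ ≤ ∑' i, volume (φ '' (R ∩ A i)) := measure_iUnion_le _
    _ ≤ ∑' i, ∫⁻ x in R ∩ A i, ENNReal.ofReal (G x + ε) ∂(Measure.hausdorffMeasure 1) := by
        refine ENNReal.tsum_le_tsum fun i =>
          mul_le_setLIntegral_of_forall_mul_le (hfin' i) (hR.inter (hAm i)) (fun h0 => ?_) (key i)
        rcases (R ∩ A i).eq_empty_or_nonempty with he | ⟨z, hz⟩
        · simp [he]
        · simpa [h0] using key i z hz
    _ = ∫⁻ x in R, ENNReal.ofReal (G x + ε) ∂(Measure.hausdorffMeasure 1) := by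
        conv_rhs => rw [hRA]
        rw [lintegral_iUnion (fun i => hR.inter (hAm i))]
        exact fun i j hij => (hAd hij).mono inter_subset_right inter_subset_right
    _ = _ := by
        simp_rw [fun x => ENNReal.ofReal_add (hG x) hε.le]
        rw [lintegral_add_right _ measurable_const, setLIntegral_const]

/-- The reverse comparison: over a small piece, `γ` is Lipschitz with constant `1 / (F z - ε)` for
each `z` in the piece, which is meaningful because `ε < c ≤ F z`. Disjoint pieces of the image have
disjoint preimages, so their times add up to at most `volume T` even if `γ` is not injective. -/
theorem setLIntegral_image_le_volume {γ : ℝ → α} (hγ : Measurable γ) {T : Set ℝ}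
    (hT : MeasurableSet T) (hTfin : volume T ≠ ⊤) (hQ : MeasurableSet (γ '' T)) {K : ℝ≥0}
    (hK : LipschitzOnWith K γ T) {F : α → ℝ} {c : ℝ} (hc : 0 < c) (hF : ∀ x, c ≤ F x)
    (h : ∀ ε : ℝ, 0 < ε → ∃ δ > 0, ∀ r ∈ T, ∀ s ∈ T, ∀ t ∈ T, dist (γ s) (γ r) < δ →
      dist (γ t) (γ r) < δ → dist (γ s) (γ t) < δ → (F (γ r) - ε) * dist (γ s) (γ t) ≤ dist s t) :
    ∫⁻ x in γ '' T, ENNReal.ofReal (F x) ∂(Measure.hausdorffMeasure 1) ≤ volume T := by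
  have hfin : Measure.hausdorffMeasure 1 (γ '' T) ≠ ⊤ := by
    refine ne_top_of_le_ne_top ?_ (hK.hausdorffMeasure_image_le zero_le_one)
    rw [hausdorffMeasure_real]
    simpa using ENNReal.mul_ne_top ENNReal.coe_ne_top hTfin
  refine ENNReal.le_of_forall_le_add_ofReal_mul hfin hc fun ε hε hεc => ?_
  obtain ⟨δ, hδ, hφ⟩ := h ε hε
  obtain ⟨A, hAm, hAd, hAu, hA⟩ := exists_measurable_partition_dist_lt (α := α) hδ
  have himg : ∀ i, γ '' T ∩ A i = γ '' (T ∩ γ ⁻¹' A i) := fun i => (image_inter_preimage γ T (A i)).symm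
  have key : ∀ i, ∀ z ∈ γ '' T ∩ A i,
      ENNReal.ofReal (F z - ε) * Measure.hausdorffMeasure 1 (γ '' T ∩ A i) ≤
        volume (T ∩ γ ⁻¹' A i) := by
    rintro i _ ⟨⟨r, hr, rfl⟩, hrA⟩
    have hpos : 0 < F (γ r) - ε := by linarith [hF (γ r)]
    have hL : LipschitzOnWith (Real.toNNReal (F (γ r) - ε))⁻¹ γ (T ∩ γ ⁻¹' A i) := by
      refine LipschitzOnWith.of_dist_le_mul fun s hs t ht => ?_
      rw [NNReal.coe_inv, Real.coe_toNNReal _ hpos.le, inv_mul_eq_div, le_div_iff₀ hpos, mul_comm]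
      exact hφ r hr s hs.1 t ht.1 (hA i _ hs.2 _ hrA) (hA i _ ht.2 _ hrA) (hA i _ hs.2 _ ht.2)
    have := hL.hausdorffMeasure_image_le (d := 1) zero_le_one
    rw [hausdorffMeasure_real, ← himg, ENNReal.rpow_one,
      ENNReal.coe_inv (Real.toNNReal_pos.2 hpos).ne', ← ENNReal.ofReal] at this
    calc _ ≤ ENNReal.ofReal (F (γ r) - ε) *
          ((ENNReal.ofReal (F (γ r) - ε))⁻¹ * volume (T ∩ γ ⁻¹' A i)) := by gcongr
      _ = _ := by
        rw [← mul_assoc, ENNReal.mul_inv_cancel (ENNReal.ofReal_pos.2 hpos).ne'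
          ENNReal.ofReal_ne_top, one_mul]
  have hRA : γ '' T = ⋃ i, γ '' T ∩ A i := by rw [← inter_iUnion, hAu, inter_univ]
  have hTA : T = ⋃ i, T ∩ γ ⁻¹' A i := by
    rw [← inter_iUnion, ← preimage_iUnion, hAu, preimage_univ, inter_univ]
  have h1 : ∫⁻ x in γ '' T, ENNReal.ofReal (F x - ε) ∂(Measure.hausdorffMeasure 1) ≤ volume T :=
    calc _ = ∑' i, ∫⁻ x in γ '' T ∩ A i, ENNReal.ofReal (F x - ε)
          ∂(Measure.hausdorffMeasure 1) := by
          conv_lhs => rw [hRA]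
          rw [lintegral_iUnion (fun i => hQ.inter (hAm i))]
          exact fun i j hij => (hAd hij).mono inter_subset_right inter_subset_right
      _ ≤ ∑' i, volume (T ∩ γ ⁻¹' A i) := ENNReal.tsum_le_tsum fun i =>
          setLIntegral_le_mul_of_forall_mul_le
            (ne_top_of_le_ne_top hfin (measure_mono inter_subset_left)) (hQ.inter (hAm i)) (key i)
      _ = volume T := by
          conv_rhs => rw [hTA]
          rw [measure_iUnion _ fun i => hT.inter (hγ (hAm i))]
          exact fun i j hij => ((hAd hij).preimage γ).mono inter_subset_right inter_subset_right
  calc _ ≤ ∫⁻ x in γ '' T, (ENNReal.ofReal (F x - ε) + ENNReal.ofReal ε)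
        ∂(Measure.hausdorffMeasure 1) := by
        refine lintegral_mono fun x => ?_
        rw [← ENNReal.ofReal_add (by linarith [hF x]) hε.le, sub_add_cancel]
    _ = ∫⁻ x in γ '' T, ENNReal.ofReal (F x - ε) ∂(Measure.hausdorffMeasure 1) +
        ENNReal.ofReal ε * Measure.hausdorffMeasure 1 (γ '' T) := by
        rw [lintegral_add_right _ measurable_const, setLIntegral_const]
    _ ≤ _ := by gcongr

end Pieces

/-! ### Geometry of the cube and local Lipschitz bounds for C¹ functions on it. -/

section Cube

variable {n : ℕ}

theorem isCompact_cube (n : ℕ) : IsCompact (cube n) := by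
  have : cube n = (EuclideanSpace.equiv (Fin n) ℝ).toHomeomorph ⁻¹'
      (univ.pi fun _ => Icc (-1 : ℝ) 1) := by
    ext x
    simp [cube, Set.mem_pi, -Set.pi_univ_Icc]
  rw [this, Homeomorph.isCompact_preimage]
  exact isCompact_univ_pi fun _ => isCompact_Icc

theorem measurableSet_cube (n : ℕ) : MeasurableSet (cube n) :=
  (isCompact_cube n).isClosed.measurableSet

theorem convex_cube (n : ℕ) : Convex ℝ (cube n) := fun x hx y hy a b ha hb hab i => by
  simpa using convex_Icc (-1 : ℝ) 1 (hx i) (hy i) ha hb hab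

theorem convex_openCube (n : ℕ) : Convex ℝ (openCube n) := fun x hx y hy a b ha hb hab i => by
  simpa using convex_Ioo (-1 : ℝ) 1 (hx i) (hy i) ha hb hab

theorem openCube_subset_cube (n : ℕ) : openCube n ⊆ cube n := fun _ hx i =>
  Ioo_subset_Icc_self (hx i)

theorem smul_mem_openCube {x : EuclideanSpace ℝ (Fin n)} (hx : x ∈ cube n) {t : ℝ}
    (ht : t ∈ Ioo (0 : ℝ) 1) : t • x ∈ openCube n := fun i => by
  have := hx i
  simp only [PiLp.smul_apply, smul_eq_mul, mem_Icc, mem_Ioo] at this ht ⊢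
  constructor <;> nlinarith

theorem zero_mem_cube (n : ℕ) : (0 : EuclideanSpace ℝ (Fin n)) ∈ cube n := fun i => by simp

/-- The nearest-point retraction of `ℝⁿ` onto the cube. -/
noncomputable def clamp {n : ℕ} (x : EuclideanSpace ℝ (Fin n)) : EuclideanSpace ℝ (Fin n) :=
  WithLp.toLp 2 fun i => max (-1) (min 1 (x i))

theorem clamp_mem_cube (x : EuclideanSpace ℝ (Fin n)) : clamp x ∈ cube n := fun i => by
  simp [clamp]

theorem clamp_eq_self {x : EuclideanSpace ℝ (Fin n)} (hx : x ∈ cube n) : clamp x = x := by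
  ext i
  have := hx i
  simp [clamp, this.1, this.2]

theorem lipschitzWith_clamp : LipschitzWith 1 (clamp (n := n)) := by
  refine LipschitzWith.of_dist_le_mul fun x y => ?_
  rw [NNReal.coe_one, one_mul, EuclideanSpace.dist_eq, EuclideanSpace.dist_eq]
  gcongr with i
  simp only [clamp, Real.dist_eq]
  calc _ ≤ |min 1 (x i) - min 1 (y i)| := by
        rw [max_comm, max_comm (-1)]; exact abs_max_sub_max_le_abs _ _ _
    _ ≤ _ := by simpa using abs_min_sub_min_le_max 1 (x i) 1 (y i)

/-- On the cube a function with gradient `g` is locally Lipschitz with the constant `|g|`. -/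
theorem IsC1WithGradient.exists_abs_sub_le {φ : EuclideanSpace ℝ (Fin n) → ℝ}
    {g : EuclideanSpace ℝ (Fin n) → EuclideanSpace ℝ (Fin n)} (h : IsC1WithGradient φ g)
    {ε : ℝ} (hε : 0 < ε) : ∃ δ > 0, ∀ z ∈ cube n, ∀ x ∈ cube n, ∀ y ∈ cube n, dist x z < δ →
      dist y z < δ → |φ x - φ y| ≤ (‖g z‖ + ε) * dist x y := by
  obtain ⟨δ, hδ, hg⟩ := Metric.uniformContinuousOn_iff.1
    ((isCompact_cube n).uniformContinuousOn_of_continuous h.continuousOn_gradient) ε hε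
  refine ⟨δ, hδ, fun z hz x hx y hy hxz hyz => ?_⟩
  -- The gradient is only known inside the open cube, so points are shrunk to `t • w`, the mean
  -- value inequality is used there, and `t` tends to 1.
  have htend : ∀ w ∈ cube n, Tendsto (fun t : ℝ => t • w) (𝓝[<] 1) (𝓝 w) := fun w _ =>
    ((continuous_id.smul continuous_const).tendsto' 1 w (by simp)).mono_left nhdsWithin_le_nhds
  have hI : ∀ᶠ t : ℝ in 𝓝[<] 1, t ∈ Ioo (0 : ℝ) 1 := Ioo_mem_nhdsLT one_pos
  have hφ : ∀ w ∈ cube n, Tendsto (fun t : ℝ => φ (t • w)) (𝓝[<] 1) (𝓝 (φ w)) := fun w hw =>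
    (h.continuousOn w hw).tendsto.comp (tendsto_nhdsWithin_iff.2
      ⟨htend w hw, hI.mono fun t ht => openCube_subset_cube n (smul_mem_openCube hw ht)⟩)
  have hball : ∀ w ∈ cube n, dist w z < δ → ∀ᶠ t : ℝ in 𝓝[<] 1, dist (t • w) z < δ :=
    fun w hw hwz => (htend w hw).eventually (Metric.isOpen_ball.mem_nhds hwz)
  refine le_of_tendsto_of_tendsto ((hφ x hx).sub (hφ y hy)).abs
    (((htend x hx).dist (htend y hy)).const_mul (‖g z‖ + ε)) ?_
  filter_upwards [hI, hball x hx hxz, hball y hy hyz] with t ht htx hty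
  have hconv : Convex ℝ (openCube n ∩ Metric.ball z δ) :=
    (convex_openCube n).inter (convex_ball z δ)
  have := hconv.norm_image_sub_le_of_norm_hasFDerivWithin_le (f := φ) (C := ‖g z‖ + ε)
    (f' := fun w => InnerProductSpace.toDual ℝ _ (g w))
    (fun w hw => (h.hasGradientAt w hw.1).hasFDerivAt.hasFDerivWithinAt) (fun w hw => ?_)
    ⟨smul_mem_openCube hy ht, hty⟩ ⟨smul_mem_openCube hx ht, htx⟩
  · rwa [Real.norm_eq_abs, ← dist_eq_norm] at this
  · rw [LinearIsometryEquiv.norm_map]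
    have := hg w (openCube_subset_cube n hw.1) z hz hw.2
    rw [dist_eq_norm] at this
    linarith [norm_le_norm_add_norm_sub' (g w) (g z)]

end Cube

/-! ### The friction function, restriction to the cube, and potentials along paths. -/

namespace City

variable {n : ℕ} (X : City n)

theorem friction_of_notMem {x : EuclideanSpace ℝ (Fin n)} (hx : x ∉ X.S) : X.friction x = X.a := by
  simp [friction, hx]

theorem friction_coe (x : X.S) : X.friction x = X.b x := by
  simp [friction]

theorem friction_le_a (x : EuclideanSpace ℝ (Fin n)) : X.friction x ≤ X.a := by
  unfold friction
  split_ifs with h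
  · exact X.b_le_a ⟨x, h⟩
  · exact le_rfl

theorem isCompact_range_of_mem_lipschitzPaths {Ω : Set (EuclideanSpace ℝ (Fin n))}
    {x y : EuclideanSpace ℝ (Fin n)} {γ : unitInterval → EuclideanSpace ℝ (Fin n)}
    (hγ : γ ∈ lipschitzPaths Ω x y) : IsCompact (range γ) := by
  obtain ⟨⟨K, hK⟩, -⟩ := hγ
  exact isCompact_range hK.continuous

theorem lintegral_friction_eq {R : Set (EuclideanSpace ℝ (Fin n))} (hR : MeasurableSet R) :
    ∫⁻ z in R ∩ X.S, X.friction z ∂(Measure.hausdorffMeasure 1) +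
      X.a * Measure.hausdorffMeasure 1 (R \ X.S) =
      ∫⁻ z in R, X.friction z ∂(Measure.hausdorffMeasure 1) := by
  rw [← lintegral_inter_add_sdiff _ R X.measurableSet, ← setLIntegral_const]
  congr 1
  exact setLIntegral_congr_fun (hR.diff X.measurableSet) fun x hx =>
    (X.friction_of_notMem hx.2).symm

theorem urbanMetricOn_eq (Ω : Set (EuclideanSpace ℝ (Fin n))) (x y : EuclideanSpace ℝ (Fin n)) :
    X.urbanMetricOn Ω x y = ⨅ γ ∈ lipschitzPaths Ω x y,
      ∫⁻ z in range γ, X.friction z ∂(Measure.hausdorffMeasure 1) := by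
  unfold urbanMetricOn
  refine iInf_congr fun γ => iInf_congr fun hγ => ?_
  exact X.lintegral_friction_eq (isCompact_range_of_mem_lipschitzPaths hγ).measurableSet

/-- Clamping fixes the part of a path inside the cube. The part outside has friction `a` because `S`
lies in the cube; its clamped image is no longer and has friction at most `a`. -/
theorem urbanMetric_eq_urbanMetricOn_cube (hS : X.S ⊆ cube n) {x y : EuclideanSpace ℝ (Fin n)}
    (hx : x ∈ cube n) (hy : y ∈ cube n) : X.urbanMetric x y = X.urbanMetricOn (cube n) x y := by
  rw [urbanMetric, urbanMetricOn_eq, urbanMetricOn_eq]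
  refine le_antisymm (le_iInf₂ fun γ hγ => ?_) (le_iInf₂ fun γ hγ => ?_)
  · exact iInf₂_le γ ⟨hγ.1, subset_univ _, hγ.2.2⟩
  · have hR : MeasurableSet (range γ) := (isCompact_range_of_mem_lipschitzPaths hγ).measurableSet
    have hC := measurableSet_cube n
    obtain ⟨⟨K, hK⟩, -, h0, h1⟩ := hγ
    have hmem : clamp ∘ γ ∈ lipschitzPaths (cube n) x y :=
      ⟨⟨1 * K, lipschitzWith_clamp.comp hK⟩, range_subset_iff.2 fun t => clamp_mem_cube _,
        by simp [h0, clamp_eq_self hx], by simp [h1, clamp_eq_self hy]⟩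
    refine iInf₂_le_of_le _ hmem ?_
    have hsub : range (clamp ∘ γ) ⊆ (range γ ∩ cube n) ∪ clamp '' (range γ \ cube n) := by
      rintro _ ⟨t, rfl⟩
      by_cases ht : γ t ∈ cube n
      · exact Or.inl (by simpa [clamp_eq_self ht] using ht)
      · exact Or.inr ⟨γ t, ⟨mem_range_self t, ht⟩, rfl⟩
    rw [← lintegral_inter_add_sdiff _ (range γ) hC]
    refine (lintegral_mono_set hsub).trans ((lintegral_union_le _ _ _).trans ?_)
    refine add_le_add le_rfl ?_
    calc _ ≤ ∫⁻ _ in clamp '' (range γ \ cube n), X.a ∂(Measure.hausdorffMeasure 1) :=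
          lintegral_mono X.friction_le_a
      _ = X.a * Measure.hausdorffMeasure 1 (clamp '' (range γ \ cube n)) := setLIntegral_const ..
      _ ≤ X.a * Measure.hausdorffMeasure 1 (range γ \ cube n) := by
          refine mul_le_mul_right ?_ _
          simpa using lipschitzWith_clamp.hausdorffMeasure_image_le zero_le_one (range γ \ cube n)
      _ = ∫⁻ _ in range γ \ cube n, X.a ∂(Measure.hausdorffMeasure 1) := (setLIntegral_const ..).symm
      _ = _ := setLIntegral_congr_fun (hR.diff hC) fun z hz =>
          (X.friction_of_notMem fun h => hz.2 (hS h)).symm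

theorem enorm_le_friction {g : EuclideanSpace ℝ (Fin n) → EuclideanSpace ℝ (Fin n)}
    (h1 : ∀ x : X.S, (x : EuclideanSpace ℝ (Fin n)) ∈ cube n → ‖g x‖ ≤ X.b x)
    (h2 : ∀ x ∈ cube n \ X.S, ‖g x‖ₑ ≤ X.a) {x : EuclideanSpace ℝ (Fin n)} (hx : x ∈ cube n) :
    ‖g x‖ₑ ≤ X.friction x := by
  by_cases hS : x ∈ X.S
  · have := X.friction_coe ⟨x, hS⟩
    simp only at this
    rw [this, enorm_eq_nnnorm]
    exact_mod_cast h1 ⟨x, hS⟩ hx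
  · rw [X.friction_of_notMem hS]
    exact h2 x ⟨hx, hS⟩

theorem mem_potentials_of_enorm_le {φ : EuclideanSpace ℝ (Fin n) → ℝ}
    {g : EuclideanSpace ℝ (Fin n) → EuclideanSpace ℝ (Fin n)} (h : IsC1WithGradient φ g)
    (hg : ∀ x ∈ cube n, ‖g x‖ₑ ≤ X.friction x) : φ ∈ X.potentials := by
  refine ⟨g, h, fun x hx => ?_, fun x hx => ?_⟩
  · have := hg x hx
    rw [X.friction_coe, enorm_eq_nnnorm] at this
    exact_mod_cast this
  · rw [← X.friction_of_notMem hx.2]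
    exact hg x hx.1

/-- The image of the path under `φ` is connected, hence contains the interval between the end
values; its length is controlled by `volume_image_le_setLIntegral`. -/
theorem ofReal_sub_le_urbanMetricOn {φ : EuclideanSpace ℝ (Fin n) → ℝ} (hφ : φ ∈ X.potentials)
    (x y : EuclideanSpace ℝ (Fin n)) :
    ENNReal.ofReal (φ x - φ y) ≤ X.urbanMetricOn (cube n) x y := by
  obtain ⟨g, hg, hb, ha⟩ := hφ
  rw [urbanMetricOn_eq]
  refine le_iInf₂ fun γ hγ => ?_
  have hR := (isCompact_range_of_mem_lipschitzPaths hγ).measurableSet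
  obtain ⟨⟨K, hK⟩, hC, rfl, rfl⟩ := hγ
  have hfin : Measure.hausdorffMeasure 1 (range γ) ≠ ⊤ := by
    have h1 := hK.hausdorffMeasure_image_le (d := 1) zero_le_one univ
    have h2 := isometry_subtype_coe.hausdorffMeasure_image (d := 1)
      (Or.inl zero_le_one) (univ : Set unitInterval)
    rw [hausdorffMeasure_real, image_univ, Subtype.range_coe] at h2
    rw [image_univ, ← h2] at h1
    refine ne_top_of_le_ne_top ?_ h1
    simp [unitInterval]
  have hlip : volume (φ '' range γ) ≤
      ∫⁻ z in range γ, ENNReal.ofReal ‖g z‖ ∂(Measure.hausdorffMeasure 1) := by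
    refine volume_image_le_setLIntegral hR hfin (fun _ => norm_nonneg _) fun ε hε => ?_
    obtain ⟨δ, hδ, h⟩ := hg.exists_abs_sub_le hε
    exact ⟨δ, hδ, fun z hz x hx y hy => h z (hC hz) x (hC hx) y (hC hy)⟩
  have hconn : IsPreconnected (φ '' range γ) :=
    (isPreconnected_range hK.continuous).image φ (hg.continuousOn.mono hC)
  have hsub : Icc (φ (γ 1)) (φ (γ 0)) ⊆ φ '' range γ :=
    hconn.Icc_subset (mem_image_of_mem _ (mem_range_self _)) (mem_image_of_mem _ (mem_range_self _))
  calc ENNReal.ofReal (φ (γ 0) - φ (γ 1)) = volume (Icc (φ (γ 1)) (φ (γ 0))) :=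
        Real.volume_Icc.symm
    _ ≤ volume (φ '' range γ) := measure_mono hsub
    _ ≤ _ := hlip
    _ ≤ _ := setLIntegral_mono' hR fun z hz => by
        rw [ofReal_norm]
        exact X.enorm_le_friction hb ha (hC hz)

end City

/-! ### Weak duality. -/

theorem ofReal_integral_le_lintegral_ofReal {α : Type*} [MeasurableSpace α] (μ : Measure α)
    (f : α → ℝ) : ENNReal.ofReal (∫ x, f x ∂μ) ≤ ∫⁻ x, ENNReal.ofReal (f x) ∂μ := by
  by_cases h : Integrable f μ
  · calc _ ≤ ENNReal.ofReal (∫ x, max (f x) 0 ∂μ) :=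
        ENNReal.ofReal_le_ofReal (integral_mono h h.pos_part fun x => le_max_left _ _)
      _ = ∫⁻ x, ENNReal.ofReal (max (f x) 0) ∂μ :=
        ofReal_integral_eq_lintegral_ofReal h.pos_part (ae_of_all _ fun x => le_max_right _ _)
      _ = _ := by simp
  · simp [integral_undef h]

section Wasserstein

variable {n : ℕ} {μ ν : Measure (EuclideanSpace ℝ (Fin n))}

theorem ae_mem_cube_of_mem_transportPlans (hμ : μ (cube n)ᶜ = 0) (hν : ν (cube n)ᶜ = 0)
    {π : Measure (EuclideanSpace ℝ (Fin n) × EuclideanSpace ℝ (Fin n))}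
    (hπ : π ∈ transportPlans μ ν) : ∀ᵐ p ∂π, p.1 ∈ cube n ∧ p.2 ∈ cube n := by
  obtain ⟨-, rfl, rfl⟩ := hπ
  have h1 : ∀ᵐ x ∂(π.map Prod.fst), x ∈ cube n := hμ
  have h2 : ∀ᵐ x ∂(π.map Prod.snd), x ∈ cube n := hν
  exact (ae_of_ae_map measurable_fst.aemeasurable h1).and
    (ae_of_ae_map measurable_snd.aemeasurable h2)

theorem wasserstein_congr (hμ : μ (cube n)ᶜ = 0) (hν : ν (cube n)ᶜ = 0)
    {d d' : EuclideanSpace ℝ (Fin n) → EuclideanSpace ℝ (Fin n) → ℝ≥0∞}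
    (h : ∀ x ∈ cube n, ∀ y ∈ cube n, d x y = d' x y) : wasserstein d μ ν = wasserstein d' μ ν := by
  refine iInf_congr fun π => iInf_congr fun hπ => lintegral_congr_ae ?_
  filter_upwards [ae_mem_cube_of_mem_transportPlans hμ hν hπ] with p hp using h _ hp.1 _ hp.2

theorem City.dualValue_le_wasserstein (X : City n) [IsProbabilityMeasure μ]
    [IsProbabilityMeasure ν] (hμ : μ (cube n)ᶜ = 0) (hν : ν (cube n)ᶜ = 0) :
    X.dualValue μ ν ≤ (wasserstein (X.urbanMetricOn (cube n)) μ ν : EReal) := by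
  refine iSup₂_le fun φ hφ => ?_
  suffices h : ENNReal.ofReal ((∫ x in cube n, φ x ∂μ) - ∫ x in cube n, φ x ∂ν) ≤
      wasserstein (X.urbanMetricOn (cube n)) μ ν by
    refine le_trans ?_ (EReal.coe_ennreal_le_coe_ennreal_iff.2 h)
    rw [EReal.coe_ennreal_ofReal]
    exact_mod_cast le_max_left _ _
  refine le_iInf₂ fun π hπ => ?_
  have hae := ae_mem_cube_of_mem_transportPlans hμ hν hπ
  have hcont : ContinuousOn φ (cube n) := hφ.choose_spec.1.continuousOn
  -- Nothing is known of `φ` off the cube, so extension by zero provides a bounded measurable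
  -- function to pull back to the plan.
  set ψ := (cube n).indicator φ with hψ
  have hψm : Measurable ψ := by
    classical
    rw [hψ, ← piecewise_eq_indicator]
    exact hcont.measurable_piecewise continuousOn_const (measurableSet_cube n)
  obtain ⟨B, hB⟩ := (isCompact_cube n).exists_bound_of_continuousOn hcont
  have hψB : ∀ x, ‖ψ x‖ ≤ max B 0 := fun x => by
    by_cases hx : x ∈ cube n
    · rw [hψ, indicator_of_mem hx]
      exact (hB x hx).trans (le_max_left _ _)
    · rw [hψ, indicator_of_notMem hx]
      simp
  have := hπ.1
  rw [← integral_indicator (measurableSet_cube n), ← integral_indicator (measurableSet_cube n),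
    ← hψ, ← hπ.2.1, ← hπ.2.2, integral_map measurable_fst.aemeasurable hψm.aestronglyMeasurable,
    integral_map measurable_snd.aemeasurable hψm.aestronglyMeasurable, ← integral_sub]
  · refine (ofReal_integral_le_lintegral_ofReal _ _).trans (lintegral_mono_ae ?_)
    filter_upwards [hae] with p hp
    rw [hψ, indicator_of_mem hp.1, indicator_of_mem hp.2]
    exact X.ofReal_sub_le_urbanMetricOn hφ p.1 p.2
  · exact Integrable.of_bound (hψm.comp measurable_fst).aestronglyMeasurable _
      (ae_of_all _ fun p => hψB p.1)
  · exact Integrable.of_bound (hψm.comp measurable_snd).aestronglyMeasurable _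
      (ae_of_all _ fun p => hψB p.2)

end Wasserstein

/-! ### Lipschitz approximation of the friction from below. -/

/-- The largest `M`-Lipschitz function below `min f M`. -/
noncomputable def lipschitzEnvelope {α : Type*} [PseudoMetricSpace α] (f : α → ℝ≥0∞) (M : ℝ)
    (x : α) : ℝ :=
  ⨅ y, ((min (f y) (ENNReal.ofReal M)).toReal + M * dist x y)

section Envelope

variable {α : Type*} [PseudoMetricSpace α] {f : α → ℝ≥0∞} {M N c : ℝ}

theorem bddBelow_lipschitzEnvelope (hM : 0 ≤ M) (x : α) :
    BddBelow (range fun y => (min (f y) (ENNReal.ofReal M)).toReal + M * dist x y) :=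
  ⟨0, by rintro _ ⟨y, rfl⟩; positivity⟩

theorem lipschitzEnvelope_le_add (hM : 0 ≤ M) (x y : α) :
    lipschitzEnvelope f M x ≤ (min (f y) (ENNReal.ofReal M)).toReal + M * dist x y :=
  ciInf_le (bddBelow_lipschitzEnvelope hM x) y

theorem lipschitzEnvelope_le (hM : 0 ≤ M) (x : α) : lipschitzEnvelope f M x ≤ M := by
  refine (lipschitzEnvelope_le_add hM x x).trans ?_
  simpa using ENNReal.toReal_le_of_le_ofReal hM (min_le_right _ _)

theorem ofReal_lipschitzEnvelope_le (hM : 0 ≤ M) (x : α) :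
    ENNReal.ofReal (lipschitzEnvelope f M x) ≤ f x := by
  refine (ENNReal.ofReal_le_ofReal (lipschitzEnvelope_le_add hM x x)).trans ?_
  rw [dist_self, mul_zero, add_zero]
  exact ENNReal.ofReal_toReal_le.trans (min_le_left _ _)

theorem le_lipschitzEnvelope [Nonempty α] (hM : 0 ≤ M) (hc : c ≤ M)
    (hf : ∀ x, ENNReal.ofReal c ≤ f x) (x : α) : c ≤ lipschitzEnvelope f M x := by
  refine le_ciInf fun y => ?_
  have : c ≤ (min (f y) (ENNReal.ofReal M)).toReal :=
    (ENNReal.ofReal_le_iff_le_toReal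
      (ne_top_of_le_ne_top ENNReal.ofReal_ne_top (min_le_right _ _))).1
      (le_min (hf y) (ENNReal.ofReal_le_ofReal hc))
  have : 0 ≤ M * dist x y := by positivity
  linarith

theorem lipschitzEnvelope_sub_le [Nonempty α] (hM : 0 ≤ M) (x y : α) :
    lipschitzEnvelope f M x - lipschitzEnvelope f M y ≤ M * dist x y := by
  rw [sub_le_comm]
  refine le_ciInf fun z => ?_
  have h1 := lipschitzEnvelope_le_add (f := f) hM x z
  have h2 : M * dist x z ≤ M * (dist x y + dist y z) := by
    gcongr
    exact dist_triangle x y z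
  linarith

theorem lipschitzEnvelope_mono [Nonempty α] (hM : 0 ≤ M) (hMN : M ≤ N) (x : α) :
    lipschitzEnvelope f M x ≤ lipschitzEnvelope f N x := by
  refine ciInf_mono (bddBelow_lipschitzEnvelope hM x) fun y => ?_
  refine add_le_add (ENNReal.toReal_mono ?_ ?_) (by gcongr)
  · exact ne_top_of_le_ne_top ENNReal.ofReal_ne_top (min_le_right _ _)
  · gcongr

/-- Given `r < f x`, points within `δ` of `x` have values above `r` by semicontinuity, and farther
points pay at least `(k + 1) * δ ≥ r` through the distance term. -/
theorem iSup_lipschitzEnvelope [Nonempty α] (hf : LowerSemicontinuous f) (x : α) :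
    ⨆ k : ℕ, ENNReal.ofReal (lipschitzEnvelope f (k + 1) x) = f x := by
  refine le_antisymm (iSup_le fun k => ofReal_lipschitzEnvelope_le (by positivity) x) ?_
  refine le_of_forall_lt fun b hb => ?_
  obtain ⟨r, hbr, hr⟩ := ENNReal.lt_iff_exists_nnreal_btwn.1 hb
  obtain ⟨δ, hδ, hball⟩ := Metric.eventually_nhds_iff.1 (hf x r hr)
  obtain ⟨k, hk⟩ := exists_nat_ge (max (r : ℝ) (r / δ))
  have hrk : (r : ℝ) ≤ k + 1 := by linarith [(le_max_left _ _).trans hk]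
  have hrδ : (r : ℝ) ≤ (k + 1) * δ := by
    have := (div_le_iff₀ hδ).1 ((le_max_right _ _).trans hk)
    nlinarith
  refine hbr.trans_le (le_iSup_of_le k ?_)
  rw [← ENNReal.ofReal_coe_nnreal]
  refine ENNReal.ofReal_le_ofReal (le_ciInf fun y => ?_)
  rcases lt_or_ge (dist y x) δ with hy | hy
  · have : (r : ℝ) ≤ (min (f y) (ENNReal.ofReal (k + 1))).toReal := by
      rw [← ENNReal.ofReal_le_iff_le_toReal
        (ne_top_of_le_ne_top ENNReal.ofReal_ne_top (min_le_right _ _)), ENNReal.ofReal_coe_nnreal]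
      refine le_min (hball hy).le ?_
      rw [← ENNReal.ofReal_coe_nnreal]
      exact ENNReal.ofReal_le_ofReal hrk
    have : 0 ≤ ((k : ℝ) + 1) * dist x y := by positivity
    linarith
  · have : ((k : ℝ) + 1) * δ ≤ (k + 1) * dist x y := by
      rw [dist_comm x]
      gcongr
    linarith [ENNReal.toReal_nonneg (a := min (f y) (ENNReal.ofReal (k + 1)))]

end Envelope

/-! ### Smoothing a function with controlled local Lipschitz constants. -/

theorem continuous_of_sub_le_mul_dist {α : Type*} [PseudoMetricSpace α] {v : α → ℝ} {M : ℝ}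
    (hv : ∀ x y, v x - v y ≤ M * (1 + dist x y) * dist x y) : Continuous v := by
  rw [continuous_iff_continuousAt]
  intro x
  have h1 : Tendsto (fun y => M * (1 + dist y x) * dist y x) (𝓝 x) (𝓝 0) :=
    Continuous.tendsto' (by fun_prop) _ _ (by simp)
  rw [ContinuousAt, tendsto_iff_dist_tendsto_zero]
  refine squeeze_zero (fun _ => dist_nonneg) (fun y => ?_) h1
  rw [Real.dist_eq, abs_le]
  have := hv x y
  rw [dist_comm x] at this
  constructor <;> linarith [hv y x]

/-- The quadratic term disappears in the difference quotient, and the directions `v` and `-v` turn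
the one-sided bound into a bound on the norm. -/
theorem norm_fderiv_le_of_sub_le {E : Type*} [NormedAddCommGroup E] [NormedSpace ℝ E] {φ : E → ℝ} {x : E} (hφ : DifferentiableAt ℝ φ x) {A M : ℝ}
    (hA : 0 ≤ A) (h : ∀ y, φ x - φ y ≤ (A + M * dist x y) * dist x y) : ‖fderiv ℝ φ x‖ ≤ A := by
  have key : ∀ v, -fderiv ℝ φ x v ≤ A * ‖v‖ := by
    intro v
    have h1 : HasDerivAt (fun s : ℝ => φ (x + s • v)) (fderiv ℝ φ x v) 0 :=
      (hφ.hasFDerivAt.hasLineDerivAt v)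
    have h2 := (hasDerivAt_iff_tendsto_slope_zero.1 h1).mono_left
      (nhdsWithin_mono 0 fun t (ht : t ∈ Ioi (0 : ℝ)) => ht.ne')
    have h3 : Tendsto (fun s : ℝ => (A + M * (s * ‖v‖)) * ‖v‖) (𝓝[>] 0) (𝓝 (A * ‖v‖)) :=
      (Continuous.tendsto' (by fun_prop) _ _ (by simp)).mono_left nhdsWithin_le_nhds
    refine le_of_tendsto_of_tendsto h2.neg h3 ?_
    filter_upwards [self_mem_nhdsWithin] with s hs
    have hs : 0 < s := hs
    have h4 := h (x + s • v)
    have h5 : dist x (x + s • v) = s * ‖v‖ := by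
      rw [dist_self_add_right, norm_smul, Real.norm_of_nonneg hs.le]
    rw [h5] at h4
    simp only [zero_add, zero_smul, add_zero, smul_eq_mul]
    rw [← mul_neg, inv_mul_le_iff₀ hs]
    linarith
  refine ContinuousLinearMap.opNorm_le_bound _ hA fun v => ?_
  have h1 := key v
  have h2 := key (-v)
  rw [map_neg, norm_neg] at h2
  rw [Real.norm_eq_abs, abs_le]
  constructor <;> linarith

section Mollification

open scoped Convolution

variable {E : Type*} [NormedAddCommGroup E] [InnerProductSpace ℝ E] [FiniteDimensional ℝ E]
  [MeasurableSpace E] [BorelSpace E]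

theorem normed_convolution_sub_le {v : E → ℝ} (hv : Continuous v) (ρ : ContDiffBump (0 : E))
    {x y : E} {B : ℝ} (h : ∀ t, ‖t‖ < ρ.rOut → v (x - t) - v (y - t) ≤ B) :
    (ρ.normed volume ⋆[ContinuousLinearMap.lsmul ℝ ℝ, volume] v) x -
      (ρ.normed volume ⋆[ContinuousLinearMap.lsmul ℝ ℝ, volume] v) y ≤ B := by
  have hint : ∀ x, Integrable fun t => ρ.normed volume t * v (x - t) := fun x =>
    (ρ.hasCompactSupport_normed.convolutionExists_left (μ := volume)
      (ContinuousLinearMap.lsmul ℝ ℝ) ρ.continuous_normed hv.locallyIntegrable) x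
  have hint' : Integrable fun t => ρ.normed (volume : Measure E) t * B :=
    (ρ.continuous_normed.integrable_of_hasCompactSupport ρ.hasCompactSupport_normed).mul_const B
  simp only [convolution_def, ContinuousLinearMap.lsmul_apply, smul_eq_mul]
  rw [← integral_sub (hint x) (hint y)]
  calc _ ≤ ∫ t, ρ.normed volume t * B := by
        refine integral_mono ((hint x).sub (hint y)) hint' fun t => ?_
        dsimp only
        rw [← mul_sub]
        by_cases ht : ‖t‖ < ρ.rOut
        · exact mul_le_mul_of_nonneg_left (h t ht) (ρ.nonneg_normed t)
        · have : ρ.normed volume t = 0 := by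
            rw [← Function.notMem_support, ρ.support_normed_eq]
            simpa using ht
          simp [this]
    _ = B := by rw [integral_mul_const, ρ.integral_normed, one_mul]

end Mollification

theorem isC1WithGradient_of_contDiff {n : ℕ} {φ : EuclideanSpace ℝ (Fin n) → ℝ}
    (h : ContDiff ℝ 1 φ) : IsC1WithGradient φ (gradient φ) where
  continuousOn := h.continuous.continuousOn
  continuousOn_gradient := ((LinearIsometryEquiv.continuous _).comp
    (h.continuous_fderiv one_ne_zero)).continuousOn
  hasGradientAt x _ := (h.differentiable one_ne_zero x).hasGradientAt

open scoped Convolution in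
/-- A function on the cube whose local Lipschitz constants are bounded by a Lipschitz function below
the friction is a uniform limit of potentials. -/
theorem City.exists_potential_abs_sub_le {n : ℕ} (X : City n) {u F : EuclideanSpace ℝ (Fin n) → ℝ}
    {M c : ℝ} (hM : 0 ≤ M) (hlip : ∀ x y, F x - F y ≤ M * dist x y) (hc : 0 < c)
    (hcF : ∀ x, c ≤ F x) (hub : ∀ x, F x ≤ M) (hF : ∀ x, ENNReal.ofReal (F x) ≤ X.friction x)
    (hu : ∀ x ∈ cube n, ∀ y ∈ cube n, u x - u y ≤ stepCost F M x y) {ε : ℝ} (hε : 0 < ε) :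
    ∃ φ ∈ X.potentials, ∀ x ∈ cube n, |φ x - u x| ≤ ε := by
  set v : EuclideanSpace ℝ (Fin n) → ℝ := fun x => u (clamp x) with hv
  have hdist : ∀ x y : EuclideanSpace ℝ (Fin n), dist (clamp x) (clamp y) ≤ dist x y := fun x y => by
    simpa using lipschitzWith_clamp.dist_le_mul x y
  have hv1 : ∀ x y, v x - v y ≤ (F (clamp x) + M * dist x y) * dist x y := fun x y => by
    refine (hu _ (clamp_mem_cube x) _ (clamp_mem_cube y)).trans ?_
    have := hc.trans_le (hcF (clamp x))
    have := hdist x y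
    unfold stepCost
    gcongr
  have hv2 : ∀ x y, v x - v y ≤ M * (1 + dist x y) * dist x y := fun x y => by
    refine (hv1 x y).trans ?_
    gcongr
    linarith [hub (clamp x)]
  have hvc : Continuous v := continuous_of_sub_le_mul_dist hv2
  obtain ⟨B, hB⟩ := (isCompact_cube n).exists_bound_of_continuousOn hvc.continuousOn
  -- The first term is the mollification error, the second the error of shrinking by `c / (c + M *
  -- η)`; `η` makes the sum at most `ε`.
  have hlim : Tendsto (fun η : ℝ => M * (1 + η) * η + (1 - c / (c + M * η)) * B) (𝓝[>] 0) (𝓝 0) := by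
    have h1 : ContinuousAt (fun η : ℝ => M * (1 + η) * η + (1 - c / (c + M * η)) * B) 0 := by
      have : c + M * 0 ≠ 0 := by simpa using hc.ne'
      fun_prop (disch := assumption)
    have h2 := h1.tendsto.mono_left (nhdsWithin_le_nhds (s := Ioi 0))
    simpa [hc.ne'] using h2
  obtain ⟨η, hη, hη0⟩ := ((hlim.eventually_le_const hε).and self_mem_nhdsWithin).exists
  have hη0 : 0 < η := hη0
  let ρ : ContDiffBump (0 : EuclideanSpace ℝ (Fin n)) := ⟨η / 2, η, half_pos hη0, half_lt_self hη0⟩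
  set ψ := (ρ.normed volume ⋆[ContinuousLinearMap.lsmul ℝ ℝ, volume] v) with hψ
  have hψd : ContDiff ℝ 1 ψ := ρ.hasCompactSupport_normed.contDiff_convolution_left
    (ContinuousLinearMap.lsmul ℝ ℝ) ρ.contDiff_normed hvc.locallyIntegrable
  have hψg : ∀ x ∈ cube n, ‖fderiv ℝ ψ x‖ ≤ F x + M * η := fun x hx => by
    refine norm_fderiv_le_of_sub_le (hψd.differentiable one_ne_zero x)
      (by have := hc.trans_le (hcF x); positivity) (M := M) fun y => normed_convolution_sub_le hvc ρ fun t ht => ?_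
    refine (hv1 _ _).trans ?_
    rw [dist_sub_right]
    gcongr
    -- Averaging over radius `η` samples `F` within `η` of `x`, after clamping, so the gradient
    -- bound grows by at most `M * η`.
    have h1 := hlip (clamp (x - t)) (clamp x)
    have h2 : M * dist (clamp (x - t)) (clamp x) ≤ M * η := by
      gcongr
      refine (hdist _ _).trans ?_
      rw [dist_eq_norm, sub_sub_cancel_left, norm_neg]
      exact ht.le
    rw [clamp_eq_self hx] at h1 h2
    linarith
  have hψv : ∀ x, |ψ x - v x| ≤ M * (1 + η) * η := fun x => by
    refine ContDiffBump.dist_normed_convolution_le hvc.aestronglyMeasurable fun y hy => ?_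
    have hy : dist y x < η := hy
    have h1 := hv2 y x
    have h2 := hv2 x y
    rw [dist_comm x] at h2
    have h3 : M * (1 + dist y x) * dist y x ≤ M * (1 + η) * η := by gcongr
    rw [Real.dist_eq, abs_le]
    constructor <;> linarith
  -- Since `c ≤ F`, one has `θ * (F + M * η) ≤ F`: shrinking by `θ` restores the gradient
  -- constraint.
  set θ := c / (c + M * η) with hθ
  have hden : 0 < c + M * η := by positivity
  have hθ0 : 0 ≤ θ := by positivity
  have hθ1 : θ ≤ 1 := (div_le_one hden).2 (by nlinarith)
  refine ⟨fun x => θ * ψ x, X.mem_potentials_of_enorm_le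
    (isC1WithGradient_of_contDiff (contDiff_const.mul hψd)) fun x hx => ?_, fun x hx => ?_⟩
  · rw [← ofReal_norm]
    refine (ENNReal.ofReal_le_ofReal ?_).trans (hF x)
    rw [gradient, LinearIsometryEquiv.norm_map,
      fderiv_const_mul (hψd.differentiable one_ne_zero x), norm_smul, Real.norm_of_nonneg hθ0]
    refine (mul_le_mul_of_nonneg_left (hψg x hx) hθ0).trans ?_
    rw [hθ, div_mul_eq_mul_div, div_le_iff₀ hden]
    nlinarith [mul_nonneg (mul_nonneg hM hη0.le) (sub_nonneg.2 (hcF x))]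
  · have h1 := hψv x
    have h2 := hB x hx
    have h3 : v x = u x := by simp [hv, clamp_eq_self hx]
    rw [h3] at h1 h2
    rw [Real.norm_eq_abs] at h2
    calc |θ * ψ x - u x| = |θ * (ψ x - u x) - (1 - θ) * u x| := by ring_nf
      _ ≤ |θ * (ψ x - u x)| + |(1 - θ) * u x| := abs_sub _ _
      _ = θ * |ψ x - u x| + (1 - θ) * |u x| := by
        rw [abs_mul, abs_mul, abs_of_nonneg hθ0, abs_of_nonneg (sub_nonneg.2 hθ1)]
      _ ≤ 1 * (M * (1 + η) * η) + (1 - θ) * B := by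
        have := sub_nonneg.2 hθ1
        gcongr
      _ ≤ ε := by linarith

/-! ### The approximating metrics on the cube and their supremum. -/

namespace City

variable {n : ℕ} (X : City n)

/-- Lipschitz functions increasing to the friction function. -/
noncomputable def envelope (k : ℕ) : EuclideanSpace ℝ (Fin n) → ℝ :=
  lipschitzEnvelope X.friction (k + 1)

/-- Step costs on the cube that approximate the urban metric from below. -/
noncomputable def cubeStepCost (k : ℕ) : cube n → cube n → ℝ :=
  stepCost (fun x : cube n => X.envelope k x) (k + 1)

/-- The pseudo-metrics on the cube that approximate the urban metric from below. -/
noncomputable def cubeDist (k : ℕ) : cube n → cube n → ℝ :=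
  chainDist (X.cubeStepCost k)

variable {X} {c : ℝ}

theorem envelope_le (k : ℕ) (x : EuclideanSpace ℝ (Fin n)) : X.envelope k x ≤ k + 1 :=
  lipschitzEnvelope_le (by positivity) x

theorem envelope_sub_le (k : ℕ) (x y : EuclideanSpace ℝ (Fin n)) :
    X.envelope k x - X.envelope k y ≤ (k + 1) * dist x y :=
  lipschitzEnvelope_sub_le (by positivity) x y

theorem envelope_mono (x : EuclideanSpace ℝ (Fin n)) : Monotone fun k => X.envelope k x :=
  fun i j hij => lipschitzEnvelope_mono (by positivity) (by gcongr) x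

theorem continuous_envelope (k : ℕ) : Continuous (X.envelope k) :=
  (LipschitzWith.of_le_add_mul (⟨k + 1, by positivity⟩ : ℝ≥0) fun x y => by
    have := envelope_sub_le (X := X) k x y
    change X.envelope k x ≤ X.envelope k y + (k + 1) * dist x y
    linarith).continuous

theorem ofReal_envelope_le (k : ℕ) (x : EuclideanSpace ℝ (Fin n)) :
    ENNReal.ofReal (X.envelope k x) ≤ X.friction x :=
  ofReal_lipschitzEnvelope_le (by positivity) x

/-- The condition `c ≤ 1` keeps `c` below the truncation level `k + 1` already at `k = 0`. -/
theorem le_envelope (hc1 : c ≤ 1) (hcX : ∀ x, ENNReal.ofReal c ≤ X.friction x) (k : ℕ)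
    (x : EuclideanSpace ℝ (Fin n)) : c ≤ X.envelope k x :=
  le_lipschitzEnvelope (by positivity) (by linarith [Nat.cast_nonneg (α := ℝ) k]) hcX x

theorem cubeStepCost_nonneg (hc : 0 < c) (hc1 : c ≤ 1) (hcX : ∀ x, ENNReal.ofReal c ≤ X.friction x)
    (k : ℕ) (x y : cube n) : 0 ≤ X.cubeStepCost k x y :=
  stepCost_nonneg (by positivity) (fun x => hc.le.trans (le_envelope hc1 hcX k x)) x y

theorem cubeDist_nonneg (hc : 0 < c) (hc1 : c ≤ 1) (hcX : ∀ x, ENNReal.ofReal c ≤ X.friction x)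
    (k : ℕ) (x y : cube n) : 0 ≤ X.cubeDist k x y :=
  chainDist_nonneg (cubeStepCost_nonneg hc hc1 hcX k)

theorem envelope_mul_dist_le_cubeDist (hc : 0 < c) (hc1 : c ≤ 1)
    (hcX : ∀ x, ENNReal.ofReal c ≤ X.friction x) (k : ℕ) (x y : cube n) :
    (X.envelope k x - (k + 1) * dist x y) * dist x y ≤ X.cubeDist k x y :=
  sub_mul_dist_le_chainDist (f := fun x : cube n => X.envelope k x) (by positivity)
    (fun x => hc.le.trans (le_envelope hc1 hcX k x)) (fun x y => envelope_sub_le k x.1 y.1) x y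

theorem mul_dist_le_cubeDist (hc : 0 < c) (hc1 : c ≤ 1)
    (hcX : ∀ x, ENNReal.ofReal c ≤ X.friction x) (k : ℕ) (x y : cube n) :
    c * dist x y ≤ X.cubeDist k x y :=
  mul_dist_le_chainDist (by positivity) (fun x : cube n => le_envelope hc1 hcX k x) x y hc.le

/-- The friction along a Lipschitz curve that is locally `1`-Lipschitz for the envelope weights. -/
theorem setLIntegral_friction_image_le (hlsc : LowerSemicontinuous X.friction) (hc : 0 < c)
    (hc1 : c ≤ 1) (hcX : ∀ x, ENNReal.ofReal c ≤ X.friction x) {γ : ℝ → EuclideanSpace ℝ (Fin n)}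
    {K : ℝ≥0} (hK : LipschitzWith K γ) {D : ℝ}
    (h : ∀ j : ℕ, ∀ s ∈ Icc 0 D, ∀ t ∈ Icc 0 D, s ≤ t →
      (X.envelope j (γ s) - (j + 1) * dist (γ s) (γ t)) * dist (γ s) (γ t) ≤ t - s) :
    ∫⁻ z in γ '' Icc 0 D, X.friction z ∂(Measure.hausdorffMeasure 1) ≤ ENNReal.ofReal D := by
  have hQ : MeasurableSet (γ '' Icc 0 D) := (isCompact_Icc.image hK.continuous).measurableSet
  calc _ = ∫⁻ z in γ '' Icc 0 D, ⨆ k : ℕ, ENNReal.ofReal (X.envelope k z)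
        ∂(Measure.hausdorffMeasure 1) :=
        lintegral_congr fun z => (iSup_lipschitzEnvelope hlsc z).symm
    _ = ⨆ k : ℕ, ∫⁻ z in γ '' Icc 0 D, ENNReal.ofReal (X.envelope k z)
        ∂(Measure.hausdorffMeasure 1) :=
        lintegral_iSup (fun k => (continuous_envelope k).measurable.ennreal_ofReal)
          fun i j hij z => ENNReal.ofReal_le_ofReal (envelope_mono z hij)
    _ ≤ ENNReal.ofReal D := iSup_le fun j => ?_
  refine (setLIntegral_image_le_volume hK.continuous.measurable measurableSet_Icc (by simp) hQ
    (hK.lipschitzOnWith (s := Icc 0 D)) hc (le_envelope hc1 hcX j) fun ε hε => ?_).trans (by simp)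
  have hj : (0 : ℝ) < j + 1 := by positivity
  -- Half of `ε` pays for the change of the envelope between `γ r` and the starting point, half for
  -- the term `(j + 1) * dist`.
  refine ⟨ε / (2 * (j + 1)), by positivity, fun r hr s hs t ht hsr htr hst => ?_⟩
  rw [lt_div_iff₀ (by positivity)] at hsr htr hst
  have e1 := envelope_sub_le (X := X) j (γ r) (γ s)
  have e2 := envelope_sub_le (X := X) j (γ r) (γ t)
  rw [dist_comm] at e1 e2
  rcases le_total s t with hle | hle
  · rw [dist_comm s, Real.dist_eq, abs_of_nonneg (sub_nonneg.2 hle)]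
    refine (mul_le_mul_of_nonneg_right ?_ dist_nonneg).trans (h j s hs t ht hle)
    linarith
  · rw [Real.dist_eq, abs_of_nonneg (sub_nonneg.2 hle)]
    rw [dist_comm (γ s)] at hst ⊢
    refine (mul_le_mul_of_nonneg_right ?_ dist_nonneg).trans (h j t ht s hs hle)
    linarith

/-- The urban metric on the cube is at most the supremum of the approximating metrics. -/
theorem urbanMetricOn_le_iSup_cubeDist (hlsc : LowerSemicontinuous X.friction) (hc : 0 < c)
    (hc1 : c ≤ 1) (hcX : ∀ x, ENNReal.ofReal c ≤ X.friction x) (x y : cube n) :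
    X.urbanMetricOn (cube n) x y ≤ ⨆ k, ENNReal.ofReal (X.cubeDist k x y) := by
  have : CompactSpace (cube n) := isCompact_iff_compactSpace.1 (isCompact_cube n)
  refine le_of_forall_gt_imp_ge_of_dense fun b hb => ?_
  obtain ⟨D, hD, hDb⟩ := ENNReal.lt_iff_exists_nnreal_btwn.1 hb
  refine le_trans ?_ hDb.le
  have hDk : ∀ k, X.cubeDist k x y < D := fun k => by
    have h := (le_iSup (fun k => ENNReal.ofReal (X.cubeDist k x y)) k).trans_lt hD
    rw [← ENNReal.ofReal_coe_nnreal] at h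
    exact (ENNReal.ofReal_lt_ofReal_iff_of_nonneg (cubeDist_nonneg hc hc1 hcX k x y)).1 h
  obtain ⟨γ, h0, h1, hγ⟩ : ∃ γ : ℝ → cube n, γ 0 = x ∧ γ D = y ∧
      ∀ s t, 0 ≤ s → s ≤ t → ∀ j, X.cubeDist j (γ s) (γ t) ≤ t - s :=
    exists_curve_chainDist_le hc (fun k (x : cube n) => le_envelope hc1 hcX k x.1)
      (fun k x => envelope_le k x.1) (fun x => envelope_mono x.1) hDk
  have hD0 : (0 : ℝ) ≤ D := D.2
  -- Freezing the curve outside `[0, D]` makes it globally Lipschitz, with constant `c⁻¹` because `c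
  -- * dist ≤ cubeDist`.
  let η : ℝ → EuclideanSpace ℝ (Fin n) := fun t => γ (projIcc 0 (D : ℝ) hD0 t)
  have hηL : LipschitzWith (Real.toNNReal c⁻¹) η := by
    refine LipschitzWith.of_dist_le_mul fun s t => ?_
    rw [Real.coe_toNNReal _ (inv_nonneg.2 hc.le), Real.dist_eq]
    have hp : ∀ s t, s ≤ t → dist (η s) (η t) ≤ c⁻¹ * |s - t| := fun s t hst => by
      have h1 := (mul_dist_le_cubeDist hc hc1 hcX 0 _ _).trans
        (hγ _ _ (projIcc 0 (D : ℝ) hD0 s).2.1 (monotone_projIcc hD0 hst) 0)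
      have h2 := abs_projIcc_sub_projIcc hD0 (c := t) (d := s)
      rw [inv_mul_eq_div, le_div_iff₀ hc, mul_comm, abs_sub_comm s t]
      exact h1.trans ((le_abs_self _).trans h2)
    rcases le_total s t with hst | hst
    · exact hp s t hst
    · rw [dist_comm, abs_sub_comm]
      exact hp t s hst
  have hηγ : ∀ t ∈ Icc (0 : ℝ) D, η t = γ t := fun t ht => by simp [η, projIcc_of_mem hD0 ht]
  have hcost := setLIntegral_friction_image_le hlsc hc hc1 hcX hηL (D := D)
    fun j s hs t ht hst => by
      rw [hηγ s hs, hηγ t ht]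
      exact (envelope_mul_dist_le_cubeDist hc hc1 hcX j (γ s) (γ t)).trans (hγ s t hs.1 hst j)
  rw [ENNReal.ofReal_coe_nnreal] at hcost
  rw [urbanMetricOn_eq]
  have hpath : (fun t : unitInterval => η (D * t)) ∈ lipschitzPaths (cube n) x.1 y.1 := by
    refine ⟨⟨Real.toNNReal c⁻¹ * (D * 1), hηL.comp ?_⟩, ?_, ?_, ?_⟩
    · refine LipschitzWith.of_dist_le_mul fun s t => ?_
      rw [mul_one, Real.dist_eq, ← mul_sub, abs_mul, abs_of_nonneg hD0]
      exact le_rfl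
    · rintro _ ⟨t, rfl⟩
      exact (γ _).2
    · simp [hηγ 0 ⟨le_rfl, hD0⟩, h0]
    · simp [hηγ D ⟨hD0, le_rfl⟩, h1]
  refine iInf₂_le_of_le _ hpath (le_trans (lintegral_mono_set ?_) hcost)
  rintro _ ⟨t, rfl⟩
  exact mem_image_of_mem η ⟨mul_nonneg hD0 t.2.1, mul_le_of_le_one_right hD0 t.2.2⟩

end City

/-! ### Kantorovich duality for an increasing sequence of continuous costs. -/

section Kantorovich

open CompactlySupported

theorem ContinuousMap.integrable_of_compactSpace {α : Type*} [TopologicalSpace α]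
    [CompactSpace α] [MeasurableSpace α] [BorelSpace α] (φ : C(α, ℝ)) (μ : Measure α)
    [IsFiniteMeasure μ] : Integrable φ μ :=
  φ.continuous.integrable_of_hasCompactSupport (HasCompactSupport.of_compactSpace _)

variable {α : Type*} [TopologicalSpace α] [CompactSpace α] [T2Space α] [MeasurableSpace α]
  [BorelSpace α]

/-- A positive functional on the continuous functions on a compact space is an integral. -/
theorem exists_measure_integral_eq (Λ : C(α, ℝ) →ₗ[ℝ] ℝ) (hΛ : ∀ f, (∀ x, 0 ≤ f x) → 0 ≤ Λ f) :
    ∃ π : Measure α, IsFiniteMeasure π ∧ ∀ f : C(α, ℝ), ∫ x, f x ∂π = Λ f := by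
  let Φ : C_c(α, ℝ) →ₚ[ℝ] ℝ := PositiveLinearMap.mk₀
    { toFun := fun f => Λ f.toContinuousMap
      map_add' := fun f g => Λ.map_add f.toContinuousMap g.toContinuousMap
      map_smul' := fun c f => Λ.map_smul c f.toContinuousMap } fun f hf => hΛ _ hf
  refine ⟨RealRMK.rieszMeasure Φ, inferInstance, fun f => ?_⟩
  exact RealRMK.integral_rieszMeasure Φ (CompactlySupportedContinuousMap.continuousMapEquiv f)

variable {μ ν : Measure α} [IsProbabilityMeasure μ] [IsProbabilityMeasure ν]

/-- The cone of triples `(φ, ψ, h)` with `l (V - D j) ≤ φ ⊕ ψ + h` for some `j` and `l ≥ 0`. -/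
def kantorovichCone (D : ℕ → C(α × α, ℝ)) (hD : Monotone D) (V : ℝ) :
    PointedCone ℝ (C(α, ℝ) × C(α, ℝ) × C(α × α, ℝ)) where
  carrier := {q | ∃ j, ∃ l : ℝ, 0 ≤ l ∧
    ∀ x y, l * (V - D j (x, y)) ≤ q.1 x + q.2.1 y + q.2.2 (x, y)}
  zero_mem' := ⟨0, 0, le_rfl, by simp⟩
  add_mem' := by
    rintro p q ⟨i, l, hl, hp⟩ ⟨j, m, hm, hq⟩
    refine ⟨max i j, l + m, add_nonneg hl hm, fun x y => ?_⟩
    have h1 : l * D i (x, y) ≤ l * D (max i j) (x, y) :=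
      mul_le_mul_of_nonneg_left (hD (le_max_left i j) (x, y)) hl
    have h2 : m * D j (x, y) ≤ m * D (max i j) (x, y) :=
      mul_le_mul_of_nonneg_left (hD (le_max_right i j) (x, y)) hm
    have h3 := hp x y
    have h4 := hq x y
    simp only [Prod.fst_add, Prod.snd_add, ContinuousMap.add_apply]
    nlinarith
  smul_mem' := by
    rintro a p ⟨i, l, hl, hp⟩
    refine ⟨i, a * l, mul_nonneg a.2 hl, fun x y => ?_⟩
    have := mul_le_mul_of_nonneg_left (hp x y) a.2
    change (a : ℝ) * l * _ ≤ (a : ℝ) * p.1 x + (a : ℝ) * p.2.1 y + (a : ℝ) * p.2.2 (x, y)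
    linarith

/-- The functional `(φ, ψ, h) ↦ ∫ φ dμ + ∫ ψ dν`. -/
noncomputable def marginalFunctional (μ ν : Measure α) [IsProbabilityMeasure μ]
    [IsProbabilityMeasure ν] : (C(α, ℝ) × C(α, ℝ) × C(α × α, ℝ)) →ₗ[ℝ] ℝ where
  toFun q := ∫ x, q.1 x ∂μ + ∫ x, q.2.1 x ∂ν
  map_add' p q := by
    simp only [Prod.fst_add, Prod.snd_add, ContinuousMap.add_apply]
    rw [integral_add (p.1.integrable_of_compactSpace μ) (q.1.integrable_of_compactSpace μ),
      integral_add (p.2.1.integrable_of_compactSpace ν) (q.2.1.integrable_of_compactSpace ν)]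
    ring
  map_smul' a p := by
    simp [integral_const_mul, mul_add]

/-- Kantorovich duality on a compact space for an increasing sequence of continuous costs: a bound
for all dual problems is attained by one plan. -/
theorem exists_plan_integral_le [SecondCountableTopology α] [HasOuterApproxClosed α]
    {D : ℕ → C(α × α, ℝ)} (hD : Monotone D)
    {V : ℝ} (h : ∀ (j : ℕ) (φ ψ : C(α, ℝ)), (∀ x y, φ x + ψ y ≤ D j (x, y)) →
      ∫ x, φ x ∂μ + ∫ x, ψ x ∂ν ≤ V) :
    ∃ π : Measure (α × α), IsProbabilityMeasure π ∧ π.map Prod.fst = μ ∧ π.map Prod.snd = ν ∧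
      ∀ j, ∫ p, D j p ∂π ≤ V := by
  -- On the subspace of triples with `h = 0` the functional is prescribed; it is extended to all
  -- triples, staying nonnegative on the cone.
  let p : Submodule ℝ (C(α, ℝ) × C(α, ℝ) × C(α × α, ℝ)) :=
    LinearMap.ker ((LinearMap.snd ℝ C(α, ℝ) C(α × α, ℝ)).comp (LinearMap.snd ℝ C(α, ℝ) _))
  have hp : ∀ {q}, q ∈ p ↔ q.2.2 = 0 := by simp [p]
  have hnonneg : ∀ q : p, (q : C(α, ℝ) × C(α, ℝ) × C(α × α, ℝ)) ∈ kantorovichCone D hD V →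
      0 ≤ (marginalFunctional μ ν).toPMap p q := by
    rintro ⟨⟨φ, ψ, f⟩, hq⟩ ⟨j, l, hl, hle⟩
    have hf : f = 0 := hp.1 hq
    subst hf
    change 0 ≤ ∫ x, φ x ∂μ + ∫ x, ψ x ∂ν
    have iφ := φ.integrable_of_compactSpace μ
    have iψ := ψ.integrable_of_compactSpace ν
    simp only [ContinuousMap.zero_apply, add_zero] at hle
    rcases hl.eq_or_lt with rfl | hl
    · have h1 : ∀ y, 0 ≤ ∫ x, φ x ∂μ + ψ y := fun y => by
        have := integral_nonneg (μ := μ) (f := fun x => φ x + ψ y) fun x => by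
          simpa using hle x y
        rw [integral_add iφ (integrable_const _)] at this
        simpa using this
      have := integral_nonneg (μ := ν) (f := fun y => ∫ x, φ x ∂μ + ψ y) h1
      rw [integral_add (integrable_const _) iψ] at this
      simpa using this
    -- Dividing by `l` makes `(V - φ / l, -ψ / l)` admissible for `D j`, so its dual value is at
    -- most `V`, which says `∫ φ + ∫ ψ ≥ 0`.
    · have := h j (ContinuousMap.const α V - l⁻¹ • φ) (-(l⁻¹ • ψ)) fun x y => by
        have := hle x y
        rw [← le_div_iff₀' hl, add_div, div_eq_inv_mul, div_eq_inv_mul] at this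
        simp only [ContinuousMap.sub_apply, ContinuousMap.const_apply, ContinuousMap.smul_apply,
          ContinuousMap.neg_apply, smul_eq_mul]
        linarith
      simp only [ContinuousMap.sub_apply, ContinuousMap.const_apply, ContinuousMap.smul_apply,
          ContinuousMap.neg_apply, smul_eq_mul] at this
      rw [integral_sub (integrable_const _) (iφ.const_mul _), integral_neg, integral_const_mul,
        integral_const_mul] at this
      simp only [integral_const, probReal_univ, one_smul] at this
      have h2 : 0 ≤ l⁻¹ * (∫ x, φ x ∂μ + ∫ x, ψ x ∂ν) := by linarith
      exact (mul_nonneg_iff_of_pos_left (inv_pos.2 hl)).1 h2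
  have hdense : ∀ q, ∃ q' : p, (q' : C(α, ℝ) × C(α, ℝ) × C(α × α, ℝ)) + q ∈
      kantorovichCone D hD V := by
    rintro ⟨φ, ψ, f⟩
    -- A large constant in the first slot brings any triple into the cone with `l = 0`.
    refine ⟨⟨(ContinuousMap.const α (‖φ‖ + ‖ψ‖ + ‖f‖), 0, 0), hp.2 rfl⟩, 0, 0, le_rfl,
      fun x y => ?_⟩
    have h1 := (abs_le.1 (φ.norm_coe_le_norm x)).1
    have h2 := (abs_le.1 (ψ.norm_coe_le_norm y)).1
    have h3 := (abs_le.1 (f.norm_coe_le_norm (x, y))).1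
    simp only [Prod.mk_add_mk, zero_mul, ContinuousMap.add_apply, ContinuousMap.const_apply,
      zero_add]
    linarith
  obtain ⟨g, hg, hgpos⟩ := riesz_extension (kantorovichCone D hD V)
    ((marginalFunctional μ ν).toPMap p) hnonneg hdense
  have hg' : ∀ φ ψ : C(α, ℝ), g (φ, ψ, 0) = ∫ x, φ x ∂μ + ∫ x, ψ x ∂ν := fun φ ψ =>
    hg ⟨(φ, ψ, 0), hp.2 rfl⟩
  let Λ : C(α × α, ℝ) →ₗ[ℝ] ℝ := g.comp ((LinearMap.inr ℝ C(α, ℝ) _).comp (LinearMap.inr ℝ _ _))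
  have hΛ : ∀ f, Λ f = g (0, 0, f) := fun f => rfl
  have hmarg : ∀ φ ψ : C(α, ℝ), Λ (φ.comp ContinuousMap.fst + ψ.comp ContinuousMap.snd) =
      ∫ x, φ x ∂μ + ∫ x, ψ x ∂ν := by
    intro φ ψ
    set f : C(α × α, ℝ) := φ.comp ContinuousMap.fst + ψ.comp ContinuousMap.snd with hf
    -- This triple and its negative both lie in the cone with `l = 0`, so `g` vanishes on it; this
    -- fixes the marginals of the measure representing `Λ`.
    have h1 := hgpos (φ, ψ, -f) ⟨0, 0, le_rfl, fun x y => by simp [hf]⟩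
    have h2 := hgpos (-φ, -ψ, f) ⟨0, 0, le_rfl, fun x y => by simp [hf]; linarith⟩
    have e1 : g (φ, ψ, -f) = g (φ, ψ, 0) - Λ f := by
      rw [hΛ, ← map_sub]
      simp
    have e2 : g (-φ, -ψ, f) = -(g (φ, ψ, -f)) := by
      rw [← map_neg]
      simp
    rw [← hg']
    linarith
  obtain ⟨π, hπ, hint⟩ := exists_measure_integral_eq Λ fun f hf =>
    hgpos (0, 0, f) ⟨0, 0, le_rfl, fun x y => by simpa using hf (x, y)⟩
  have h1 : π.map Prod.fst = μ := by
    refine ext_of_forall_integral_eq_of_IsFiniteMeasure fun f => ?_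
    rw [integral_map measurable_fst.aemeasurable f.continuous.aestronglyMeasurable]
    have := hmarg f.toContinuousMap 0
    rw [← hint] at this
    simpa using this
  have h2 : π.map Prod.snd = ν := by
    refine ext_of_forall_integral_eq_of_IsFiniteMeasure fun f => ?_
    rw [integral_map measurable_snd.aemeasurable f.continuous.aestronglyMeasurable]
    have := hmarg 0 f.toContinuousMap
    rw [← hint] at this
    simpa using this
  refine ⟨π, ⟨?_⟩, h1, h2, fun j => ?_⟩
  · rw [← measure_univ (μ := μ), ← h1, Measure.map_apply measurable_fst MeasurableSet.univ,
      preimage_univ]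
  · rw [hint]
    -- With `l = 1` this triple is in the cone for every `j`, which is why one plan serves all
    -- costs.
    have h3 := hgpos (ContinuousMap.const α V, 0, -D j)
      ⟨j, 1, zero_le_one, fun x y => by simp [sub_eq_add_neg]⟩
    have e : g (ContinuousMap.const α V, 0, -D j) = g (ContinuousMap.const α V, 0, 0) - Λ (D j) := by
      rw [hΛ, ← map_sub]
      simp
    rw [e, hg'] at h3
    simpa using h3

end Kantorovich

/-! ### Strong duality and conclusion. -/

namespace City

variable {n : ℕ} {X : City n} {c : ℝ} {μ ν : Measure (EuclideanSpace ℝ (Fin n))}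

theorem isProbabilityMeasure_comap_cube [IsProbabilityMeasure μ] (hμ : μ (cube n)ᶜ = 0) :
    IsProbabilityMeasure (μ.comap ((↑) : cube n → EuclideanSpace ℝ (Fin n))) := by
  refine ⟨?_⟩
  rw [(MeasurableEmbedding.subtype_coe (measurableSet_cube n)).comap_apply, image_univ,
    Subtype.range_coe]
  exact (prob_compl_eq_zero_iff (measurableSet_cube n)).1 hμ

theorem map_comap_cube (hμ : μ (cube n)ᶜ = 0) :
    (μ.comap ((↑) : cube n → EuclideanSpace ℝ (Fin n))).map (↑) = μ := by
  rw [map_comap_subtype_coe (measurableSet_cube n)]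
  exact Measure.restrict_eq_self_of_ae_mem hμ

theorem zero_mem_potentials : (fun _ => 0) ∈ X.potentials :=
  X.mem_potentials_of_enorm_le (isC1WithGradient_of_contDiff contDiff_const)
    fun x _ => by simp [gradient]

theorem zero_le_dualValue : 0 ≤ X.dualValue μ ν :=
  le_iSup₂_of_le _ zero_mem_potentials (by simp)

/-- The transform `u x = inf_y (d x y - ψ y)` satisfies `φ ≤ u ≤ -ψ` and inherits `u x - u y ≤ d x
y` from the triangle inequality. A potential within `ε / 2` of `u` then bounds the pair up to `ε`.
-/
theorem integral_add_integral_le_of_le_cubeDist [IsProbabilityMeasure μ] [IsProbabilityMeasure ν]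
    (hμ : μ (cube n)ᶜ = 0) (hν : ν (cube n)ᶜ = 0) (hc : 0 < c) (hc1 : c ≤ 1)
    (hcX : ∀ x, ENNReal.ofReal c ≤ X.friction x) {V : ℝ}
    (hV : ∀ φ ∈ X.potentials, (∫ x in cube n, φ x ∂μ) - ∫ x in cube n, φ x ∂ν ≤ V)
    (j : ℕ) (φ ψ : C(cube n, ℝ)) (h : ∀ x y, φ x + ψ y ≤ X.cubeDist j x y) :
    ∫ x, φ x ∂(μ.comap ((↑) : cube n → EuclideanSpace ℝ (Fin n))) +
      ∫ x, ψ x ∂(ν.comap ((↑) : cube n → EuclideanSpace ℝ (Fin n))) ≤ V := by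
  have : CompactSpace (cube n) := isCompact_iff_compactSpace.1 (isCompact_cube n)
  have := isProbabilityMeasure_comap_cube hμ
  have := isProbabilityMeasure_comap_cube hν
  have hne : Nonempty (cube n) := ⟨⟨0, zero_mem_cube n⟩⟩
  have hw := cubeStepCost_nonneg hc hc1 hcX j
  let u : cube n → ℝ := fun x => ⨅ y, (X.cubeDist j x y - ψ y)
  have hbdd : ∀ x, BddBelow (range fun y => X.cubeDist j x y - ψ y) := fun x =>
    ⟨φ x, by rintro _ ⟨y, rfl⟩; linarith [h x y]⟩
  have hφu : ∀ x, φ x ≤ u x := fun x => le_ciInf fun y => by linarith [h x y]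
  have huψ : ∀ x, u x ≤ -ψ x := fun x => by
    have h1 : u x ≤ X.cubeDist j x x - ψ x := ciInf_le (hbdd x) x
    have h2 : X.cubeDist j x x = 0 := chainDist_self hw x
    linarith
  have hu : ∀ x y, u x - u y ≤ X.cubeStepCost j x y := fun x y => by
    rw [sub_le_comm]
    refine le_ciInf fun z => ?_
    have h1 : u x ≤ X.cubeDist j x z - ψ z := ciInf_le (hbdd x) z
    have h2 : X.cubeDist j x z ≤ X.cubeDist j x y + X.cubeDist j y z :=
      chainDist_triangle hw x y z
    have h3 : X.cubeDist j x y ≤ X.cubeStepCost j x y := chainDist_le hw x y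
    linarith
  refine le_of_forall_pos_le_add fun ε hε => ?_
  obtain ⟨f, hf, hfu⟩ := X.exists_potential_abs_sub_le
    (u := fun x => u ⟨clamp x, clamp_mem_cube x⟩) (F := X.envelope j) (M := (j : ℝ) + 1)
    (by positivity) (envelope_sub_le j) hc (le_envelope hc1 hcX j) (envelope_le j)
    (ofReal_envelope_le j) (fun x hx y hy => by
      have := hu ⟨x, hx⟩ ⟨y, hy⟩
      simp only [clamp_eq_self hx, clamp_eq_self hy]
      exact this) (half_pos hε)
  have hfu' : ∀ x : cube n, |f x - u x| ≤ ε / 2 := fun x => by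
    have := hfu x x.2
    simpa only [clamp_eq_self x.2] using this
  have hfc : Continuous fun x : cube n => f x :=
    continuousOn_iff_continuous_domRestrict.1 hf.choose_spec.1.continuousOn
  let g : C(cube n, ℝ) := ⟨fun x => f x, hfc⟩
  have hfV := hV f hf
  rw [← integral_subtype_comap (measurableSet_cube n), ← integral_subtype_comap
    (measurableSet_cube n)] at hfV
  have i1 := g.integrable_of_compactSpace (μ.comap ((↑) : cube n → EuclideanSpace ℝ (Fin n)))
  have i2 := g.integrable_of_compactSpace (ν.comap ((↑) : cube n → EuclideanSpace ℝ (Fin n)))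
  have h1 := integral_mono (φ.integrable_of_compactSpace _) (i1.add (integrable_const (ε / 2)))
    fun x => show φ x ≤ g x + ε / 2 by
      have : |g x - u x| ≤ ε / 2 := hfu' x
      linarith [hφu x, (abs_le.1 this).1]
  have h2 := integral_mono (ψ.integrable_of_compactSpace _)
    ((integrable_const (ε / 2)).sub i2) fun x => show ψ x ≤ ε / 2 - g x by
      have : |g x - u x| ≤ ε / 2 := hfu' x
      linarith [huψ x, (abs_le.1 this).2]
  simp only [Pi.add_apply, Pi.sub_apply] at h1 h2
  rw [integral_add i1 (integrable_const _)] at h1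
  rw [integral_sub (integrable_const _) i2] at h2
  simp only [integral_const, probReal_univ, one_smul] at h1 h2
  change ∫ x, g x ∂_ - ∫ x, g x ∂_ ≤ V at hfV
  linarith

theorem wasserstein_urbanMetricOn_le [IsProbabilityMeasure μ] [IsProbabilityMeasure ν]
    (hμ : μ (cube n)ᶜ = 0) (hν : ν (cube n)ᶜ = 0) (hlsc : LowerSemicontinuous X.friction)
    (hc : 0 < c) (hc1 : c ≤ 1) (hcX : ∀ x, ENNReal.ofReal c ≤ X.friction x) {V : ℝ}
    (hV : ∀ φ ∈ X.potentials, (∫ x in cube n, φ x ∂μ) - ∫ x in cube n, φ x ∂ν ≤ V) :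
    wasserstein (X.urbanMetricOn (cube n)) μ ν ≤ ENNReal.ofReal V := by
  have : CompactSpace (cube n) := isCompact_iff_compactSpace.1 (isCompact_cube n)
  have := isProbabilityMeasure_comap_cube hμ
  have := isProbabilityMeasure_comap_cube hν
  let D : ℕ → C(cube n × cube n, ℝ) := fun k => ⟨fun p => X.cubeDist k p.1 p.2,
    continuous_chainDist (by positivity) (fun x => hc.le.trans (le_envelope hc1 hcX k x.1))
      fun x => envelope_le k x.1⟩
  have hD : Monotone D := fun i j hij p =>
    chainDist_mono (cubeStepCost_nonneg hc hc1 hcX i)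
      (stepCost_mono (by gcongr) fun x => envelope_mono x.1 hij) p.1 p.2
  obtain ⟨π, hπ, h1, h2, hle⟩ := exists_plan_integral_le hD
    (integral_add_integral_le_of_le_cubeDist hμ hν hc hc1 hcX hV)
  let ι : cube n × cube n → EuclideanSpace ℝ (Fin n) × EuclideanSpace ℝ (Fin n) :=
    Prod.map (↑) (↑)
  have hι : Measurable ι := measurable_subtype_coe.prodMap measurable_subtype_coe
  have hplan : π.map ι ∈ transportPlans μ ν := by
    refine ⟨Measure.isProbabilityMeasure_map hι.aemeasurable, ?_, ?_⟩
    · rw [Measure.map_map measurable_fst hι, ← map_comap_cube hμ, ← h1,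
        Measure.map_map measurable_subtype_coe measurable_fst]
      rfl
    · rw [Measure.map_map measurable_snd hι, ← map_comap_cube hν, ← h2,
        Measure.map_map measurable_subtype_coe measurable_snd]
      rfl
  calc wasserstein (X.urbanMetricOn (cube n)) μ ν
      ≤ ∫⁻ p, X.urbanMetricOn (cube n) p.1 p.2 ∂(π.map ι) := iInf₂_le _ hplan
    -- This direction of the change of variables needs no measurability of the urban metric.
    _ ≤ ∫⁻ p, X.urbanMetricOn (cube n) (ι p).1 (ι p).2 ∂π := lintegral_map_le _ _
    _ ≤ ∫⁻ p, ⨆ k, ENNReal.ofReal (D k p) ∂π :=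
        lintegral_mono fun p => urbanMetricOn_le_iSup_cubeDist hlsc hc hc1 hcX p.1 p.2
    _ = ⨆ k, ∫⁻ p, ENNReal.ofReal (D k p) ∂π :=
        lintegral_iSup (fun k => (D k).continuous.measurable.ennreal_ofReal)
          fun i j hij p => ENNReal.ofReal_le_ofReal (hD hij p)
    _ ≤ ENNReal.ofReal V := iSup_le fun k => by
        rw [← ofReal_integral_eq_lintegral_ofReal ((D k).integrable_of_compactSpace π)
          (ae_of_all _ fun p => cubeDist_nonneg hc hc1 hcX k p.1 p.2)]
        exact ENNReal.ofReal_le_ofReal (hle k)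

theorem urbanMetricOn_cube_of_a_eq_zero (ha : X.a = 0) {x y : EuclideanSpace ℝ (Fin n)}
    (hx : x ∈ cube n) (hy : y ∈ cube n) : X.urbanMetricOn (cube n) x y = 0 := by
  rw [urbanMetricOn_eq, ← nonpos_iff_eq_zero]
  have hpath : (fun t : unitInterval => AffineMap.lineMap x y (t : ℝ)) ∈
      lipschitzPaths (cube n) x y := by
    refine ⟨⟨nndist x y * 1, (lipschitzWith_lineMap x y).comp (LipschitzWith.subtype_val _)⟩, ?_,
      by simp, by simp⟩
    rintro _ ⟨t, rfl⟩
    exact (convex_cube n).lineMap_mem hx hy t.2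
  refine iInf₂_le_of_le _ hpath ?_
  have : X.friction = fun _ => 0 := funext fun z => by
    simpa [ha] using X.friction_le_a z
  simp [this]

theorem exists_pos_le_friction (ha : X.a ≠ 0) (hpos : ∃ c : ℝ≥0, 0 < c ∧ ∀ x : X.S, c ≤ X.b x) :
    ∃ c : ℝ, 0 < c ∧ c ≤ 1 ∧ ∀ x, ENNReal.ofReal c ≤ X.friction x := by
  obtain ⟨c, hc, hb⟩ := hpos
  have htop : min X.a 1 ≠ ⊤ := ne_top_of_le_ne_top ENNReal.one_ne_top (min_le_right _ _)
  have hne : min X.a 1 ≠ 0 := (lt_min (pos_iff_ne_zero.2 ha) one_pos).ne'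
  -- The minimum with 1 keeps the constant finite when `a = ⊤` and provides `c ≤ 1`.
  refine ⟨min c (min X.a 1).toReal, lt_min (by exact_mod_cast hc)
    (ENNReal.toReal_pos hne htop), (min_le_right _ _).trans ?_, fun x => ?_⟩
  · exact ENNReal.toReal_le_of_le_ofReal zero_le_one (by simp)
  · by_cases hx : x ∈ X.S
    · refine (ENNReal.ofReal_le_ofReal (min_le_left _ _)).trans ?_
      rw [ENNReal.ofReal_coe_nnreal, X.friction_coe ⟨x, hx⟩]
      exact_mod_cast hb ⟨x, hx⟩
    · refine (ENNReal.ofReal_le_ofReal (min_le_right _ _)).trans ?_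
      rw [ENNReal.ofReal_toReal htop, X.friction_of_notMem hx]
      exact min_le_left _ _

theorem wasserstein_le_dualValue [IsProbabilityMeasure μ] [IsProbabilityMeasure ν]
    (hμ : μ (cube n)ᶜ = 0) (hν : ν (cube n)ᶜ = 0) (hlsc : LowerSemicontinuous X.friction)
    (hpos : ∃ c : ℝ≥0, 0 < c ∧ ∀ x : X.S, c ≤ X.b x) :
    (wasserstein (X.urbanMetricOn (cube n)) μ ν : EReal) ≤ X.dualValue μ ν := by
  -- If `a = 0` the friction vanishes and has no positive lower bound, but then every transport
  -- inside the cube is free.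
  by_cases ha : X.a = 0
  · have hprod : μ.prod ν ∈ transportPlans μ ν :=
      ⟨inferInstance, Measure.fst_prod, Measure.snd_prod⟩
    have h0 : wasserstein (X.urbanMetricOn (cube n)) μ ν = 0 := by
      refine le_antisymm ((iInf₂_le _ hprod).trans_eq ?_) bot_le
      rw [← lintegral_zero (μ := μ.prod ν)]
      refine lintegral_congr_ae ?_
      filter_upwards [ae_mem_cube_of_mem_transportPlans hμ hν hprod] with p hp
      exact urbanMetricOn_cube_of_a_eq_zero ha hp.1 hp.2
    rw [h0]
    exact zero_le_dualValue
  · obtain ⟨c, hc, hc1, hcX⟩ := exists_pos_le_friction ha hpos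
    rcases eq_or_ne (X.dualValue μ ν) ⊤ with htop | htop
    · rw [htop]
      exact le_top
    · have hcoe : ((X.dualValue μ ν).toReal : EReal) = X.dualValue μ ν :=
        EReal.coe_toReal htop (ne_bot_of_le_ne_bot EReal.zero_ne_bot zero_le_dualValue)
      have hV0 : 0 ≤ (X.dualValue μ ν).toReal := EReal.toReal_nonneg zero_le_dualValue
      have h := wasserstein_urbanMetricOn_le hμ hν hlsc hc hc1 hcX
        (V := (X.dualValue μ ν).toReal) fun φ hφ => by
          rw [← EReal.coe_le_coe_iff, hcoe]
          exact le_iSup₂_of_le φ hφ le_rfl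
      refine (EReal.coe_ennreal_le_coe_ennreal_iff.2 h).trans ?_
      rw [EReal.coe_ennreal_ofReal, max_eq_left hV0, hcoe]

end City

theorem mainTheorem1 (n : ℕ) (X : City n)
    (hpos : ∃ c : ℝ≥0, 0 < c ∧ ∀ x : X.S, c ≤ X.b x)
    (hlsc : LowerSemicontinuous X.friction)
    (μ ν : Measure (EuclideanSpace ℝ (Fin n)))
    [IsProbabilityMeasure μ] [IsProbabilityMeasure ν]
    (hμ : μ (cube n)ᶜ = 0) (hν : ν (cube n)ᶜ = 0) :
    (X.S ⊆ cube n → (wasserstein X.urbanMetric μ ν : EReal) = X.dualValue μ ν) ∧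
      (wasserstein (X.urbanMetricOn (cube n)) μ ν : EReal) = X.dualValue μ ν := by
  have h := le_antisymm (City.wasserstein_le_dualValue hμ hν hlsc hpos)
    (X.dualValue_le_wasserstein hμ hν)
  refine ⟨fun hS => ?_, h⟩
  rw [← h, wasserstein_congr hμ hν fun x hx y hy => X.urbanMetric_eq_urbanMetricOn_cube hS hx hy]
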